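/- **Optimization problems.** A maximization problem $P=(I,\mathrm{sol},m)$ consists of a set $I$ of instances, a set $\mathrm{sol}(x)$ of feasible solutions for each $x\in I$, and a measure $m(x,y)\ge 0$ for $y\in\mathrm{sol}(x)$; $m^*(x)=\max_{y\in\mathrm{sol}(x)}m(x,y)$. For $\alpha\ge1$, a solution $y\in\mathrm{sol}(x)$ is *$\alpha$-approximate* if $1/\alpha\le |m(x,y)/m^*(x)|\le\alpha$ when $m^*(x)\neq0$, and $m(x,y)=0$ when $m^*(x)=0$. A *randomized approximation scheme* for $P$ is a randomized algorithm that, on input $(x,\varepsilon)\in I\times(0,1)$, outputs a $2^{\varepsilon}$-approximate solution $y\in\mathrm{sol}(x)$ with probability at least $3/4$. **APT-reductions.** $P$ is *APT-reducible* to $Q=(I',\mathrm{sol}',m')$, written $P\le_{\mathrm{APT}}Q$, if there are a randomized oracle algorithm $N$, taking inputs $(x,\varepsilon)\in I\times(0,1)$, and polynomials $p,q$ in two variables such that, for every randomized approximation scheme $M$ for $Q$ (not necessarily of polynomial running time) used as oracle: (i) $N$ with oracle $M$ is a randomized approximation scheme for $P$; (ii) every oracle call made by $N$ on input $(x,\varepsilon)$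 is of the form $(w,\delta)\in I'\times(0,1)$ with $1/\delta\le p(|x|,1/\varepsilon)$, and is answered by an outcome of $M$ on $(w,\delta)$; (iii) $N$ on input $(x,\varepsilon)$ halts on every computation path within $q(|x|,1/\varepsilon)$ steps. Here $N$ and the polynomials $p,q$ do not depend on $M$. Algorithms run on a random access machine with coin flips and oracle calls, in which a real number (a weight, a value of a constraint, or $\varepsilon$) occupies one cell, real numbers can be copied, compared, added, subtracted, multiplied and divided, integers can be copied, compared, incremented and decremented, and each operation costs one step; $|x|$ is the length of the representation of $x$, a real number counting as one symbol. **The problems.** A constraint of arity $k$ is a function $f:\{0,1\}^k\to\mathbb{R}^{\ge0}$, represented by the list of its values in lexicographic order; $OR=(0,1,1,1)$ and $Implies=(1,1,0,1)$. For a set $\mathcal F$ of constraints, an instance of MAX-PROD-CSP$(\mathcal F)$ is a finite set $H$ of pairs $\langle h,(x_{i_1},\dots,x_{i_k})\rangle$ on Boolean variables $x_1,\dots,x_n$, where $h\in\mathcal F$ has arity $k$ and $i_1,\dots,i_k\in\{1,\dots,n\}$; the solutions are the assignments $\sigma:\{x_1,\dots,x_n\}\to\{0,1\}$, and the measure of $\sigma$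 is $\prod_{\langle h,(x_{i_1},\dots,x_{i_k})\rangle\in H}h(\sigma(x_{i_1}),\dots,\sigma(x_{i_k}))$. MAX-PROD-CSP$^*(\mathcal F)$ is MAX-PROD-CSP$(\mathcal F\cup\mathcal U)$, where $\mathcal U$ is the set of all constraints of arity $1$. An instance of MAX-PROD-IS is a finite undirected graph $G=(V,E)$ with vertex weights $w_v\in\mathbb{R}^{\ge0}$ ($v\in V$); the solutions are the independent sets $A\subseteq V$ of $G$, with measure $\prod_{v\in A}w_v$. MAX-PROD-BIS is MAX-PROD-IS restricted to bipartite graphs. **Lemma.** 1. $\text{MAX-PROD-IS}\le_{\mathrm{APT}}\text{MAX-PROD-CSP}^*(OR)$. 2. $\text{MAX-PROD-BIS}\le_{\mathrm{APT}}\text{MAX-PROD-CSP}^*(Implies)$. -/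

import Mathlib

open scoped NNReal ENNReal

noncomputable section

/-! ### Words over natural numbers and real numbers -/

/-- The strings handled by the machines: a string of natural numbers (structural data such as
bits and indices) and a string of real numbers (weights), a real number being one symbol. -/
@[ext] structure Word where
  nats : List ℕ
  reals : List ℝ

/-- Length of a word; natural numbers are counted in unary, a real number counts as one. -/
def Word.size (d : Word) : ℕ := (d.nats.map (· + 1)).sum + d.reals.length

/-! ### Maximization problems, approximate solutions, randomized approximation schemes -/

/-- A maximization problem `(I, sol, m)` with the representation of its instances and solutions
as words. `Sol x` is the type of feasible solutions of the instance `x`. -/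
structure MaxProblem where
  Inst : Type
  Sol : Inst → Type
  measure : (x : Inst) → Sol x → ℝ≥0
  encInst : Inst → Word
  encSol : (x : Inst) → Sol x → Word
  encInst_injective : Function.Injective encInst
  encSol_injective : ∀ x, Function.Injective (encSol x)

/-- `y` is an `α`-approximate solution of the instance `x`. -/
def MaxProblem.IsApprox (P : MaxProblem) (α : ℝ) (x : P.Inst) (y : P.Sol x) : Prop :=
  ∃ mstar : ℝ≥0, IsGreatest (Set.range (P.measure x)) mstar ∧
    (mstar = 0 → P.measure x y = 0) ∧
    (mstar ≠ 0 → 1 / α ≤ |(P.measure x y : ℝ) / (mstar : ℝ)| ∧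
      |(P.measure x y : ℝ) / (mstar : ℝ)| ≤ α)

/-- The input-output behaviour of a randomized algorithm that takes a word and an error
tolerance and outputs a random word. -/
abbrev RandomizedMap : Type := Word → ℝ → PMF Word

/-- `M` is (the input-output behaviour of) a randomized approximation scheme for `P`: on `(x, ε)`
it outputs, with probability at least `3/4`, a `2 ^ ε`-approximate solution. The remaining outputs
are arbitrary words. -/
def MaxProblem.IsRAS (P : MaxProblem) (M : RandomizedMap) : Prop :=
  ∀ (x : P.Inst) (ε : ℝ), 0 < ε → ε < 1 →
    (3 / 4 : ℝ≥0∞) ≤ (M (P.encInst x) ε).toOuterMeasure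
      {d | ∃ y : P.Sol x, P.encSol x y = d ∧ P.IsApprox ((2 : ℝ) ^ ε) x y}

/-! ### Randomized oracle machines over the reals

A random access machine with registers for natural numbers (successor and predecessor only) and
registers for real numbers (field operations and comparison, no rounding), a memory consisting of
numbered extendible arrays, fair coin flips and oracle calls. Every elementary operation costs one
step. Array `0` holds the input, array `1` the query, array `2` the oracle's answer and array `3`
the output. -/

/-- Elementary operations. `i j k` are numbers of registers, `a` is the number of an array. -/
inductive Op
  /-- `n_i := 0` -/
  | zero (i : ℕ)
  /-- `n_i := n_i + 1` -/
  | succ (i : ℕ)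
  /-- `n_i := n_i - 1`, truncated at `0` -/
  | pred (i : ℕ)
  /-- `n_i := n_j` -/
  | copy (i j : ℕ)
  /-- `n_i :=` length of the natural number part of array `a` -/
  | len (i a : ℕ)
  /-- `n_i := a[n_j]` (`0` outside the array) -/
  | load (i a j : ℕ)
  /-- `a[n_j] := n_i` (no effect outside the array) -/
  | store (a j i : ℕ)
  /-- append `n_i` to the array `a` -/
  | push (a i : ℕ)
  /-- `r_i := 0` -/
  | rzero (i : ℕ)
  /-- `r_i := 1` -/
  | rone (i : ℕ)
  /-- `r_i := r_j` -/
  | rcopy (i j : ℕ)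
  /-- `r_i := r_j + r_k` -/
  | radd (i j k : ℕ)
  /-- `r_i := r_j - r_k` -/
  | rsub (i j k : ℕ)
  /-- `r_i := r_j * r_k` -/
  | rmul (i j k : ℕ)
  /-- `r_i := r_j / r_k` (`0` if `r_k = 0`) -/
  | rdiv (i j k : ℕ)
  /-- `n_i :=` length of the real part of array `a` -/
  | rlen (i a : ℕ)
  /-- `r_i := a[n_j]` in the real part (`0` outside the array) -/
  | rload (i a j : ℕ)
  /-- `a[n_j] := r_i` in the real part (no effect outside the array) -/
  | rstore (a j i : ℕ)
  /-- append `r_i` to the real part of array `a` -/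
  | rpush (a i : ℕ)
  /-- empty the array `a` -/
  | clear (a : ℕ)
  /-- `n_i :=` a fair random bit -/
  | flip (i : ℕ)
  /-- call the oracle on the word in array `1` with tolerance `r_i`; the answer goes to array `2` -/
  | query (i : ℕ)

/-- Tests on registers. -/
inductive Test
  /-- `n_i < n_j` -/
  | lt (i j : ℕ)
  /-- `n_i = n_j` -/
  | eq (i j : ℕ)
  /-- `r_i < r_j` -/
  | rlt (i j : ℕ)
  /-- `r_i = r_j` -/
  | req (i j : ℕ)

/-- Programs. -/
inductive Prog
  | skip
  | op (o : Op)
  | seq (p q : Prog)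
  | ite (t : Test) (p q : Prog)
  | while (t : Test) (p : Prog)

/-- Contents of the registers and of the memory. -/
structure Store where
  reg : ℕ → ℕ
  rreg : ℕ → ℝ
  mem : ℕ → Word

namespace Store

def setReg (s : Store) (i v : ℕ) : Store := { s with reg := Function.update s.reg i v }

def setRReg (s : Store) (i : ℕ) (v : ℝ) : Store := { s with rreg := Function.update s.rreg i v }

def setMem (s : Store) (a : ℕ) (d : Word) : Store := { s with mem := Function.update s.mem a d }

def setNats (s : Store) (a : ℕ) (l : List ℕ) : Store := s.setMem a ⟨l, (s.mem a).reals⟩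

def setReals (s : Store) (a : ℕ) (l : List ℝ) : Store := s.setMem a ⟨(s.mem a).nats, l⟩

end Store

/-- Effect of an elementary operation, with oracle `M`. -/
def Op.exec (M : RandomizedMap) (s : Store) : Op → PMF Store
  | .zero i => PMF.pure (s.setReg i 0)
  | .succ i => PMF.pure (s.setReg i (s.reg i + 1))
  | .pred i => PMF.pure (s.setReg i (s.reg i - 1))
  | .copy i j => PMF.pure (s.setReg i (s.reg j))
  | .len i a => PMF.pure (s.setReg i (s.mem a).nats.length)
  | .load i a j => PMF.pure (s.setReg i ((s.mem a).nats.getD (s.reg j) 0))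
  | .store a j i => PMF.pure (s.setNats a ((s.mem a).nats.set (s.reg j) (s.reg i)))
  | .push a i => PMF.pure (s.setNats a ((s.mem a).nats ++ [s.reg i]))
  | .rzero i => PMF.pure (s.setRReg i 0)
  | .rone i => PMF.pure (s.setRReg i 1)
  | .rcopy i j => PMF.pure (s.setRReg i (s.rreg j))
  | .radd i j k => PMF.pure (s.setRReg i (s.rreg j + s.rreg k))
  | .rsub i j k => PMF.pure (s.setRReg i (s.rreg j - s.rreg k))
  | .rmul i j k => PMF.pure (s.setRReg i (s.rreg j * s.rreg k))
  | .rdiv i j k => PMF.pure (s.setRReg i (s.rreg j / s.rreg k))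
  | .rlen i a => PMF.pure (s.setReg i (s.mem a).reals.length)
  | .rload i a j => PMF.pure (s.setRReg i ((s.mem a).reals.getD (s.reg j) 0))
  | .rstore a j i => PMF.pure (s.setReals a ((s.mem a).reals.set (s.reg j) (s.rreg i)))
  | .rpush a i => PMF.pure (s.setReals a ((s.mem a).reals ++ [s.rreg i]))
  | .clear a => PMF.pure (s.setMem a ⟨[], []⟩)
  | .flip i => (PMF.uniformOfFintype (Fin 2)).map fun b => s.setReg i b
  | .query i => (M (s.mem 1) (s.rreg i)).map fun d => s.setMem 2 d

def Test.holds (s : Store) : Test → Prop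
  | .lt i j => s.reg i < s.reg j
  | .eq i j => s.reg i = s.reg j
  | .rlt i j => s.rreg i < s.rreg j
  | .req i j => s.rreg i = s.rreg j

/-- A configuration: the stack of programs that remain to be executed, and the store. -/
structure Config where
  todo : List Prog
  store : Store

/-- The machine has halted. -/
def Config.Halted (c : Config) : Prop := c.todo = []

open Classical in
/-- One step of computation with oracle `M`; halted configurations do not change. -/
def Config.step (M : RandomizedMap) (c : Config) : PMF Config :=
  match c.todo with
  | [] => PMF.pure c
  | .skip :: K => PMF.pure ⟨K, c.store⟩
  | .op o :: K => (o.exec M c.store).map fun s => ⟨K, s⟩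
  | .seq p q :: K => PMF.pure ⟨p :: q :: K, c.store⟩
  | .ite t p q :: K => PMF.pure ⟨(if t.holds c.store then p else q) :: K, c.store⟩
  | .while t p :: K =>
      PMF.pure ⟨if t.holds c.store then p :: .while t p :: K else K, c.store⟩

/-- Distribution of the configuration after `n` steps. -/
def Config.run (M : RandomizedMap) : ℕ → Config → PMF Config
  | 0, c => PMF.pure c
  | n + 1, c => (c.step M).bind (Config.run M n)

/-- Initial configuration of the program `N` on input `(d, ε)`: the word `d` is in array `0`, the
number `ε` in the real register `0`, and everything else is zero or empty. -/
def Prog.start (N : Prog) (d : Word) (ε : ℝ) : Config where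
  todo := [N]
  store :=
    { reg := fun _ => 0
      rreg := Function.update (fun _ => 0) 0 ε
      mem := Function.update (fun _ => ⟨[], []⟩) 0 d }

/-- The value `p(|d|, 1/ε)` of a bivariate polynomial. -/
def polyBound (p : MvPolynomial (Fin 2) ℝ) (d : Word) (ε : ℝ) : ℝ :=
  MvPolynomial.eval ![(d.size : ℝ), 1 / ε] p

/-- Distribution of the output (the content of array `3`) of `N` with oracle `M` after
`⌊q(|d|, 1/ε)⌋` steps. -/
def Prog.outcome (N : Prog) (q : MvPolynomial (Fin 2) ℝ) (M : RandomizedMap) : RandomizedMap :=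
  fun d ε => ((N.start d ε).run M ⌊polyBound q d ε⌋₊).map fun c => c.store.mem 3

/-- `P` is APT-reducible to `Q`. -/
def APTReduces (P Q : MaxProblem) : Prop :=
  ∃ (N : Prog) (p q : MvPolynomial (Fin 2) ℝ), ∀ M : RandomizedMap, Q.IsRAS M →
    -- `N` with oracle `M` is a randomized approximation scheme for `P`
    P.IsRAS (N.outcome q M) ∧
    -- every oracle call is of the form `(w, δ)` with `w` an instance of `Q`, `0 < δ < 1` and
    -- `1/δ ≤ p(|x|, 1/ε)`
    (∀ (x : P.Inst) (ε : ℝ), 0 < ε → ε < 1 →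
      ∀ (t : ℕ), ∀ c ∈ ((N.start (P.encInst x) ε).run M t).support,
        ∀ (i : ℕ) (K : List Prog), c.todo = .op (.query i) :: K →
          (∃ w : Q.Inst, Q.encInst w = c.store.mem 1) ∧
          0 < c.store.rreg i ∧ c.store.rreg i < 1 ∧
          1 / c.store.rreg i ≤ polyBound p (P.encInst x) ε) ∧
    -- `N` halts on every computation path within `q(|x|, 1/ε)` steps
    (∀ (x : P.Inst) (ε : ℝ), 0 < ε → ε < 1 → 0 ≤ polyBound q (P.encInst x) ε ∧
      ∀ c ∈ ((N.start (P.encInst x) ε).run M ⌊polyBound q (P.encInst x) ε⌋₊).support,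
        c.Halted)

/-! ### Constraint satisfaction problems with multiplicative measure -/

/-- A nonnegative-real-weighted constraint. -/
structure Constraint where
  arity : ℕ
  val : (Fin arity → Bool) → ℝ≥0

/-- The output values of a function on `{0,1}^k` in lexicographic order. -/
def valueTable : (k : ℕ) → ((Fin k → Bool) → ℝ≥0) → List ℝ
  | 0, f => [(f Fin.elim0 : ℝ)]
  | k + 1, f => valueTable k (fun v => f (Fin.cons false v)) ++
      valueTable k (fun v => f (Fin.cons true v))

/-- The constraint `OR = (0,1,1,1)`. -/
def constraintOR : Constraint where
  arity := 2
  val := fun v => if v 0 = true ∨ v 1 = true then 1 else 0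

/-- The constraint `Implies = (1,1,0,1)`. -/
def constraintImplies : Constraint where
  arity := 2
  val := fun v => if v 0 = true → v 1 = true then 1 else 0

/-- The set of all unary constraints. -/
def unaryConstraints : Set Constraint := {f | f.arity = 1}

/-- A constraint applied to a series of variables among `n` variables. -/
structure ConstraintApp (n : ℕ) where
  con : Constraint
  vars : Fin con.arity → Fin n

/-- Instance of the constraint satisfaction problem over `F`: a finite set, listed without
repetitions, of applications of constraints from `F` to `numVars` Boolean variables. -/
structure CSPInst (F : Set Constraint) where
  numVars : ℕ
  apps : List (ConstraintApp numVars)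
  nodup : apps.Nodup
  mem : ∀ a ∈ apps, a.con ∈ F

/-- The arity followed by the indices of the variables. -/
def ConstraintApp.natCode {n : ℕ} (a : ConstraintApp n) : List ℕ :=
  a.con.arity :: List.ofFn fun j => (a.vars j : ℕ)

def ConstraintApp.realCode {n : ℕ} (a : ConstraintApp n) : List ℝ :=
  valueTable a.con.arity a.con.val

def CSPInst.enc {F : Set Constraint} (x : CSPInst F) : Word where
  nats := x.numVars :: x.apps.flatMap ConstraintApp.natCode
  reals := x.apps.flatMap ConstraintApp.realCode

def CSPInst.measure {F : Set Constraint} (x : CSPInst F) (σ : Fin x.numVars → Bool) : ℝ≥0 :=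
  (x.apps.map fun a => a.con.val fun j => σ (a.vars j)).prod

/-- The word listing `n` bits. -/
def bitWord {n : ℕ} (σ : Fin n → Bool) : Word where
  nats := List.ofFn fun i => (σ i).toNat
  reals := []

theorem bitWord_injective (n : ℕ) : Function.Injective (bitWord (n := n)) := by
  intro σ τ h
  have h1 := List.ofFn_injective (congrArg Word.nats h)
  funext i
  have h2 := congrFun h1 i
  cases hσ : σ i <;> cases hτ : τ i <;> simp_all

theorem valueTable_length (k : ℕ) (f : (Fin k → Bool) → ℝ≥0) :
    (valueTable k f).length = 2 ^ k := by
  induction k with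
  | zero => simp [valueTable]
  | succ k ih => simp [valueTable, ih, pow_succ, mul_two]

theorem valueTable_injective (k : ℕ) : Function.Injective (valueTable k) := by
  induction k with
  | zero =>
    intro f g h
    funext v
    have hv : v = Fin.elim0 := Subsingleton.elim _ _
    subst hv
    simpa [valueTable] using h
  | succ k ih =>
    intro f g h
    obtain ⟨h0, h1⟩ := List.append_inj h (by simp [valueTable_length])
    funext v
    rw [← Fin.cons_self_tail v]
    cases v 0
    · exact congrFun (ih h0) (Fin.tail v)
    · exact congrFun (ih h1) (Fin.tail v)

theorem appCode_injective {n : ℕ} (l l' : List (ConstraintApp n))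
    (h : l.flatMap ConstraintApp.natCode = l'.flatMap ConstraintApp.natCode)
    (h' : l.flatMap ConstraintApp.realCode = l'.flatMap ConstraintApp.realCode) : l = l' := by
  induction l generalizing l' with
  | nil =>
    cases l' with
    | nil => rfl
    | cons a t => simp [ConstraintApp.natCode] at h
  | cons a t ih =>
    cases l' with
    | nil => simp [ConstraintApp.natCode] at h
    | cons b t' =>
      obtain ⟨⟨k, f⟩, u⟩ := a
      obtain ⟨⟨k', f'⟩, u'⟩ := b
      simp only [List.flatMap_cons, ConstraintApp.natCode, ConstraintApp.realCode,
        List.cons_append, List.cons.injEq] at h h'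
      obtain ⟨rfl, h⟩ := h
      obtain ⟨h1, h2⟩ := List.append_inj h (by simp)
      obtain ⟨h3, h4⟩ := List.append_inj h' (by simp [valueTable_length])
      have hf := valueTable_injective _ h3
      subst hf
      have hu : u = u' := funext fun j => Fin.ext (congrFun (List.ofFn_injective h1) j)
      subst hu
      rw [ih t' h2 h4]

theorem CSPInst.enc_injective (F : Set Constraint) :
    Function.Injective (CSPInst.enc (F := F)) := by
  rintro ⟨n, l, _, _⟩ ⟨n', l', _, _⟩ h
  simp only [CSPInst.enc, Word.mk.injEq, List.cons.injEq] at h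
  obtain ⟨⟨rfl, h1⟩, h2⟩ := h
  obtain rfl := appCode_injective l l' h1 h2
  rfl

/-- MAX-PROD-CSP(`F`). -/
def maxProdCSP (F : Set Constraint) : MaxProblem where
  Inst := CSPInst F
  Sol := fun x => Fin x.numVars → Bool
  measure := fun x σ => x.measure σ
  encInst := fun x => x.enc
  encSol := fun _ σ => bitWord σ
  encInst_injective := CSPInst.enc_injective F
  encSol_injective := fun _ => bitWord_injective _

/-- MAX-PROD-CSP*(`F`): all unary constraints are free. -/
def maxProdCSPStar (F : Set Constraint) : MaxProblem := maxProdCSP (F ∪ unaryConstraints)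

/-! ### Maximum product independent set -/

/-- An undirected graph with nonnegative real vertex weights. -/
structure WeightedGraph where
  numVertices : ℕ
  graph : SimpleGraph (Fin numVertices)
  weight : Fin numVertices → ℝ≥0

open Classical in
/-- The number of vertices and the adjacency matrix, row by row; the list of weights. -/
def WeightedGraph.enc (x : WeightedGraph) : Word where
  nats := x.numVertices :: List.ofFn fun p : Fin (x.numVertices * x.numVertices) =>
    if x.graph.Adj p.divNat p.modNat then 1 else 0
  reals := List.ofFn fun v => (x.weight v : ℝ)

theorem WeightedGraph.enc_injective : Function.Injective WeightedGraph.enc := by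
  classical
  rintro ⟨n, G, w⟩ ⟨n', G', w'⟩ h
  simp only [WeightedGraph.enc, Word.mk.injEq, List.cons.injEq] at h
  obtain ⟨⟨rfl, h1⟩, h2⟩ := h
  have hw : w = w' := funext fun v => NNReal.coe_injective (congrFun (List.ofFn_injective h2) v)
  have hG : G = G' := by
    ext u v
    have h3 := congrFun (List.ofFn_injective h1) (finProdFinEquiv (u, v))
    have h4 := finProdFinEquiv.symm_apply_apply (u, v)
    rw [finProdFinEquiv_symm_apply, Prod.mk.injEq] at h4
    rw [h4.1, h4.2] at h3
    by_cases hu : G.Adj u v <;> by_cases hv : G'.Adj u v <;> simp_all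
  rw [hw, hG]

/-- The feasible solutions: independent sets. -/
abbrev WeightedGraph.IndepSet (x : WeightedGraph) : Type :=
  {A : Finset (Fin x.numVertices) // x.graph.IsIndepSet (A : Set (Fin x.numVertices))}

/-- The product of the weights of the chosen vertices. -/
def WeightedGraph.measure (x : WeightedGraph) (A : x.IndepSet) : ℝ≥0 :=
  ∏ v ∈ A.1, x.weight v

/-- An independent set is represented by its characteristic vector. -/
def WeightedGraph.encSol (x : WeightedGraph) (A : x.IndepSet) : Word :=
  bitWord fun v => decide (v ∈ A.1)

theorem WeightedGraph.encSol_injective (x : WeightedGraph) : Function.Injective x.encSol := by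
  intro A B h
  have h1 := bitWord_injective _ h
  ext v
  simpa using congrFun h1 v

/-- MAX-PROD-IS. -/
def maxProdIS : MaxProblem where
  Inst := WeightedGraph
  Sol := fun x => x.IndepSet
  measure := fun x A => x.measure A
  encInst := fun x => x.enc
  encSol := fun x A => x.encSol A
  encInst_injective := WeightedGraph.enc_injective
  encSol_injective := WeightedGraph.encSol_injective

/-- MAX-PROD-BIS: the input graphs are bipartite (no bipartition is given with the input). -/
def maxProdBIS : MaxProblem where
  Inst := {x : WeightedGraph // x.graph.IsBipartite}
  Sol := fun x => x.1.IndepSet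
  measure := fun x A => x.1.measure A
  encInst := fun x => x.1.enc
  encSol := fun x A => x.1.encSol A
  encInst_injective := fun _ _ h => Subtype.ext (WeightedGraph.enc_injective h)
  encSol_injective := fun x => x.1.encSol_injective


/-!
Let each vertex `u` carry a bit `c u`, and read an assignment `σ` as the set of the vertices with
`σ u = c u`. The constraint `a = t → b` excludes exactly one pair of values, `(t, false)`, so it
forbids that both ends of an edge be selected as soon as one end is selected by `t` and the other
one by `false`. For `OR`, where `t = false`, every vertex can be selected by `false`. For
`Implies`, where `t = true`, the two sides of a bipartition have to be selected by different bits.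
With a unary constraint of values `w u` and `1` at each vertex, the assignments of nonzero measure
are then independent sets of the same measure, and every independent set arises. Hence one oracle
call with the given tolerance suffices.

A bipartition is not part of the input. The machine finds one by giving the vertices the distinct
labels `1, …, n` and processing the edges one by one: it merges the labels `±s` and `±t` of the two
ends so that these become opposite. The signs of the final labels are a two-colouring. This takes
cubic time, and it needs no search and no recursion.
-/

noncomputable section

namespace MaxProblem

variable {P Q : MaxProblem} {α : ℝ} {x : P.Inst} {y : P.Sol x} {x' : Q.Inst} {y' : Q.Sol x'}

theorem IsApprox.measure_ne_zero (h : P.IsApprox α x y) (hα : 0 < α) {z : P.Sol x}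
    (hz : P.measure x z ≠ 0) : P.measure x y ≠ 0 := by
  obtain ⟨mstar, hmax, -, hratio⟩ := h
  intro hy
  have hmstar : mstar ≠ 0 := fun h0 => hz (le_zero_iff.1 (h0 ▸ hmax.2 ⟨z, rfl⟩))
  have hlow := (hratio hmstar).1
  rw [hy, NNReal.coe_zero, zero_div, abs_zero] at hlow
  exact (one_div_pos.2 hα).not_ge hlow

theorem IsApprox.of_measures_eq (h : Q.IsApprox α x' y') (hy : P.measure x y = Q.measure x' y')
    (hPQ : ∀ z, ∃ z', Q.measure x' z' = P.measure x z)
    (hQP : ∀ z', Q.measure x' z' ≠ 0 → ∃ z, P.measure x z = Q.measure x' z') :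
    P.IsApprox α x y := by
  obtain ⟨mstar, ⟨⟨z', rfl⟩, hmax⟩, hzero, hratio⟩ := h
  rw [← hy] at hzero hratio
  refine ⟨_, ⟨?_, ?_⟩, hzero, hratio⟩
  · by_cases h0 : Q.measure x' z' = 0
    · exact ⟨y, (hzero h0).trans h0.symm⟩
    · exact hQP z' h0
  · rintro _ ⟨z, rfl⟩
    obtain ⟨z'', hz''⟩ := hPQ z
    exact hz'' ▸ hmax ⟨z'', rfl⟩

end MaxProblem

/-! ### Independent sets as assignments -/

/-- The binary constraint `a = t → b`. It unifies `OR` (`t = false`) and `Implies` (`t = true`). -/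
def condImplies (t : Bool) : Constraint where
  arity := 2
  val := fun v => if v 0 = t → v 1 = true then 1 else 0

theorem condImplies_false : condImplies false = constraintOR := by
  simp only [condImplies, constraintOR, ← Bool.not_eq_true, or_iff_not_imp_left]

theorem condImplies_true : condImplies true = constraintImplies := rfl

/-- The unary constraint with value `w` at `b` and value `1` at the other bit. -/
def weightAt (b : Bool) (w : ℝ≥0) : Constraint where
  arity := 1
  val := fun v => if v 0 = b then w else 1

/-- The constraint `weightAt b w` on the variable `u`. -/
def weightAtApp {n : ℕ} (b : Bool) (w : ℝ≥0) (u : Fin n) : ConstraintApp n :=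
  ⟨weightAt b w, fun _ => u⟩

/-- The constraint that excludes the value `t` at the tail and `false` at the head of `e`. -/
def condImpliesApp {n : ℕ} (t : Bool) (e : Fin n × Fin n) : ConstraintApp n :=
  ⟨condImplies t, ![e.1, e.2]⟩

theorem weightAtApp_inj {n : ℕ} {b b' : Bool} {w w' : ℝ≥0} {u u' : Fin n}
    (h : weightAtApp b w u = weightAtApp b' w' u') : u = u' := by
  simpa [weightAtApp, ConstraintApp.natCode, weightAt, Fin.ext_iff] using
    congrArg ConstraintApp.natCode h

theorem condImpliesApp_injective {n : ℕ} (t : Bool) :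
    Function.Injective (condImpliesApp (n := n) t) := by
  rintro ⟨u, v⟩ ⟨u', v'⟩ h
  simpa [Fin.ext_iff, condImpliesApp, ConstraintApp.natCode, condImplies] using
    congrArg ConstraintApp.natCode h

namespace WeightedGraph

variable (x : WeightedGraph)

open Classical in
/-- Both orientations of the edges found at the first `k` entries of the adjacency matrix. -/
def arcsBefore (k : ℕ) : List (Fin x.numVertices × Fin x.numVertices) :=
  (((List.finRange (x.numVertices * x.numVertices)).take k).map finProdFinEquiv.symm).filter
    fun e => x.graph.Adj e.1 e.2

/-- Both orientations of every edge, in the order of the adjacency matrix. -/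
def arcs : List (Fin x.numVertices × Fin x.numVertices) :=
  x.arcsBefore (x.numVertices * x.numVertices)

@[simp]
theorem mem_arcs {e : Fin x.numVertices × Fin x.numVertices} :
    e ∈ x.arcs ↔ x.graph.Adj e.1 e.2 := by
  simp [arcs, arcsBefore, List.take_of_length_le, -finProdFinEquiv_symm_apply,
    Equiv.symm_apply_eq]

theorem nodup_arcs : x.arcs.Nodup :=
  (((List.nodup_finRange _).sublist (List.take_sublist _ _)).map
    finProdFinEquiv.symm.injective).filter _

variable (t : Bool) (c : Fin x.numVertices → Bool)

/-- The constraint `condImplies t` can forbid each edge `{u, v}` when a vertex `u` is selected by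
the bit `c u`: one endpoint is selected by `t` and the other one by `false`. -/
def IsSelector : Prop :=
  ∀ u v, x.graph.Adj u v → (c u = t ∧ c v = false) ∨ (c v = t ∧ c u = false)

/-- The assignment `σ` stands for the set of the vertices `u` with `σ u = c u`. A unary constraint
at each vertex accounts for its weight. -/
def toCSP : CSPInst ({condImplies t} ∪ unaryConstraints) where
  numVars := x.numVertices
  apps := (List.finRange _).map (fun u => weightAtApp (c u) (x.weight u) u) ++
    (x.arcs.filter fun e => c e.1 = t).map (condImpliesApp t)
  nodup := by
    refine .append (.map (fun _ _ => weightAtApp_inj) (List.nodup_finRange _))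
      (.map (condImpliesApp_injective t) (x.nodup_arcs.filter _)) ?_
    simp only [List.disjoint_left, List.mem_map]
    rintro _ ⟨u, -, rfl⟩ ⟨e, -, h⟩
    cases congrArg (fun a => a.con.arity) h
  mem := by
    simp only [List.mem_append, List.mem_map]
    rintro _ (⟨u, -, rfl⟩ | ⟨e, -, rfl⟩)
    exacts [Or.inr rfl, Or.inl rfl]

end WeightedGraph

/-- The set of the vertices on which `σ` agrees with `c`. -/
def agreementSet {n : ℕ} (c σ : Fin n → Bool) : Finset (Fin n) := {u | σ u = c u}

theorem exists_agreementSet_eq {n : ℕ} (c : Fin n → Bool) (A : Finset (Fin n)) :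
    ∃ σ, agreementSet c σ = A := by
  refine ⟨fun u => if u ∈ A then c u else !c u, ?_⟩
  ext u
  by_cases hu : u ∈ A <;> simp [agreementSet, hu]

namespace WeightedGraph

variable {x : WeightedGraph} {t : Bool} {c : Fin x.numVertices → Bool}

theorem toCSP_measure (σ : Fin x.numVertices → Bool) :
    (x.toCSP t c).measure σ = (∏ u ∈ agreementSet c σ, x.weight u) *
      ((x.arcs.filter fun e => c e.1 = t).map fun e =>
        if σ e.1 = t → σ e.2 = true then (1 : ℝ≥0) else 0).prod := by
  simp only [CSPInst.measure, toCSP, List.map_append, List.map_map, List.prod_append]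
  congr 1
  rw [agreementSet, Finset.prod_filter, ← List.prod_ofFn, List.ofFn_eq_map]
  rfl

namespace IsSelector

theorem isIndepSet_agreementSet_iff (hc : x.IsSelector t c) (σ : Fin x.numVertices → Bool) :
    x.graph.IsIndepSet (agreementSet c σ : Set (Fin x.numVertices)) ↔
      ∀ e ∈ x.arcs.filter fun e => c e.1 = t, σ e.1 = t → σ e.2 = true := by
  simp only [SimpleGraph.isIndepSet_iff, Set.Pairwise, agreementSet, Finset.coe_filter,
    Finset.mem_univ, true_and, Set.mem_ofPred_eq, List.mem_filter, mem_arcs, decide_eq_true_eq]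
  constructor
  · intro hindep e ⟨hadj, he⟩ hσ
    by_contra hσ'
    have := hc _ _ hadj
    exact hindep (show σ e.1 = c e.1 by grind) (show σ e.2 = c e.2 by grind) hadj.ne hadj
  · intro hsat u hu v hv _ hadj
    have huv := hsat (u, v)
    have hvu := hsat (v, u)
    grind [hc u v hadj, hadj.symm]

theorem toCSP_measure_of_isIndepSet (hc : x.IsSelector t c) {σ : Fin x.numVertices → Bool}
    (hσ : x.graph.IsIndepSet (agreementSet c σ : Set (Fin x.numVertices))) :
    (x.toCSP t c).measure σ = x.measure ⟨agreementSet c σ, hσ⟩ := by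
  rw [hc.isIndepSet_agreementSet_iff] at hσ
  rw [toCSP_measure, List.prod_eq_one, mul_one, measure]
  simp only [List.mem_map]
  rintro _ ⟨e, he, rfl⟩
  exact if_pos (hσ e he)

theorem isIndepSet_of_toCSP_measure_ne_zero (hc : x.IsSelector t c)
    {σ : Fin x.numVertices → Bool} (hσ : (x.toCSP t c).measure σ ≠ 0) :
    x.graph.IsIndepSet (agreementSet c σ : Set (Fin x.numVertices)) := by
  rw [hc.isIndepSet_agreementSet_iff]
  intro e he
  by_contra hviolated
  rw [toCSP_measure] at hσ
  refine right_ne_zero_of_mul hσ (List.prod_eq_zero (List.mem_map.2 ⟨e, he, if_neg hviolated⟩))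

end IsSelector

end WeightedGraph

/-- MAX-PROD-IS for graphs that are presented by an injective map `g` into the weighted graphs. -/
def maxProdISOn {I : Type} (g : I → WeightedGraph) (hg : Function.Injective g) : MaxProblem where
  Inst := I
  Sol := fun i => (g i).IndepSet
  measure := fun i A => (g i).measure A
  encInst := fun i => (g i).enc
  encSol := fun i A => (g i).encSol A
  encInst_injective := fun _ _ h => hg (WeightedGraph.enc_injective h)
  encSol_injective := fun i => (g i).encSol_injective

theorem WeightedGraph.IsSelector.exists_isApprox {I : Type} {g : I → WeightedGraph}
    {hg : Function.Injective g} {i : I} {t : Bool} {c : Fin (g i).numVertices → Bool}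
    (hc : (g i).IsSelector t c) {α : ℝ} (hα : 0 < α) {σ : Fin (g i).numVertices → Bool}
    (h : (maxProdCSPStar {condImplies t}).IsApprox α ((g i).toCSP t c) σ) :
    ∃ A : (g i).IndepSet, A.1 = agreementSet c σ ∧ (maxProdISOn g hg).IsApprox α i A := by
  have hmeasure : ∀ A : (g i).IndepSet, ∃ τ, ((g i).toCSP t c).measure τ = (g i).measure A := by
    rintro ⟨A, hA⟩
    obtain ⟨τ, rfl⟩ := exists_agreementSet_eq c A
    exact ⟨τ, hc.toCSP_measure_of_isIndepSet hA⟩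
  obtain ⟨τ, hτ⟩ := hmeasure ⟨∅, by simp⟩
  have hindep := hc.isIndepSet_of_toCSP_measure_ne_zero
    (h.measure_ne_zero hα (z := τ) (hτ.trans_ne (by simp [measure])))
  refine ⟨⟨_, hindep⟩, rfl, h.of_measures_eq (hc.toCSP_measure_of_isIndepSet hindep).symm hmeasure
    fun τ hτ => ⟨⟨_, hc.isIndepSet_of_toCSP_measure_ne_zero hτ⟩,
      (hc.toCSP_measure_of_isIndepSet (hc.isIndepSet_of_toCSP_measure_ne_zero hτ)).symm⟩⟩

/-! ### Two-colouring by signed labels -/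

/-- The classes of labels `±s` and `±t` are merged, `t` being identified with `-s`. -/
def mergeLabel (s t r : ℝ) : ℝ := if r = t then -s else if r = -t then s else r

/-- The labels after the step that makes the ends of the arc `e` opposite. -/
def mergeAlong {V : Type*} (ℓ : V → ℝ) (e : V × V) : V → ℝ :=
  fun w => mergeLabel (ℓ e.1) (ℓ e.2) (ℓ w)

/-- The labels, with the sign reversed at the vertices of colour `false`. -/
def unsignedLabel {V : Type*} (χ : V → Bool) (ℓ : V → ℝ) (a : V) : ℝ := if χ a then ℓ a else -ℓ a

/-- The labels `ℓ` are opposite at the ends of the arcs in `L`, and compatible with the colouring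
`χ`: among labels of the same absolute value, the sign is determined by the colour. -/
structure IsSignedLabelling {V : Type*} (χ : V → Bool) (L : List (V × V)) (ℓ : V → ℝ) : Prop where
  compatible : ∀ a b, unsignedLabel χ ℓ a ≠ -unsignedLabel χ ℓ b
  opposite : ∀ e ∈ L, ℓ e.1 = -ℓ e.2

namespace IsSignedLabelling

variable {V : Type*} {χ : V → Bool} {L L' : List (V × V)} {ℓ : V → ℝ}

theorem ne_zero (h : IsSignedLabelling χ L ℓ) (a : V) : ℓ a ≠ 0 := by
  grind [unsignedLabel, h.compatible a a]

theorem exists_unsignedLabel_mergeAlong (h : IsSignedLabelling χ L ℓ) {e : V × V}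
    (he : χ e.1 ≠ χ e.2) (a : V) :
    ∃ b, unsignedLabel χ (mergeAlong ℓ e) a = unsignedLabel χ ℓ b := by
  have ha := h.compatible a e.2
  by_cases hmerged : ℓ a = ℓ e.2 ∨ ℓ a = -ℓ e.2
  · exact ⟨e.1, by grind [mergeAlong, mergeLabel, unsignedLabel]⟩
  · exact ⟨a, by grind [mergeAlong, mergeLabel, unsignedLabel]⟩

theorem append_singleton (h : IsSignedLabelling χ L ℓ) {e : V × V} (he : χ e.1 ≠ χ e.2) :
    IsSignedLabelling χ (L ++ [e]) (mergeAlong ℓ e) := by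
  have hodd : ∀ r, mergeLabel (ℓ e.1) (ℓ e.2) (-r) = -mergeLabel (ℓ e.1) (ℓ e.2) r := by
    grind [mergeLabel, h.ne_zero e.2]
  refine ⟨fun a b => ?_, List.forall_mem_append.2 ⟨fun e' he' => ?_, ?_⟩⟩
  · obtain ⟨a', ha'⟩ := h.exists_unsignedLabel_mergeAlong he a
    obtain ⟨b', hb'⟩ := h.exists_unsignedLabel_mergeAlong he b
    rw [ha', hb']
    exact h.compatible a' b'
  · simp only [mergeAlong, h.opposite e' he', hodd]
  · rw [List.forall_mem_singleton]
    grind [mergeAlong, mergeLabel, unsignedLabel, h.compatible e.1 e.2, h.ne_zero e.2]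

theorem append (h : IsSignedLabelling χ L ℓ) (hχ : ∀ e ∈ L', χ e.1 ≠ χ e.2) :
    IsSignedLabelling χ (L ++ L') (L'.foldl mergeAlong ℓ) := by
  induction L' generalizing L ℓ with
  | nil => simpa using h
  | cons e L' ih =>
    rw [List.forall_mem_cons] at hχ
    simpa using ih (h.append_singleton hχ.1) hχ.2

end IsSignedLabelling

/-- The labels `1, …, n`. They start at `1` because a label and its opposite must differ. -/
def initialLabels (n : ℕ) (w : Fin n) : ℝ := w + 1

theorem isSignedLabelling_initialLabels {n : ℕ} (χ : Fin n → Bool) :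
    IsSignedLabelling χ [] (initialLabels n) where
  compatible a b := by
    have ha : 0 < initialLabels n a := by unfold initialLabels; positivity
    have hb : 0 < initialLabels n b := by unfold initialLabels; positivity
    have hab : initialLabels n a = initialLabels n b → a = b := by
      simp [initialLabels, Fin.val_inj]
    grind [unsignedLabel]
  opposite := by simp

/-- The vertices with positive label are selected by `true`. -/
def positiveSide {n : ℕ} (ℓ : Fin n → ℝ) (u : Fin n) : Bool := decide (0 < ℓ u)

theorem IsSignedLabelling.isSelector_positiveSide {x : WeightedGraph}
    {χ : Fin x.numVertices → Bool} {ℓ : Fin x.numVertices → ℝ}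
    (h : IsSignedLabelling χ x.arcs ℓ) : x.IsSelector true (positiveSide ℓ) := by
  intro u v hadj
  have hopp := h.opposite (u, v) (x.mem_arcs.2 hadj)
  rcases lt_or_gt_of_ne (h.ne_zero v) with hv | hv
  · left
    simp [positiveSide, hopp, hv, hv.le]
  · right
    simp [positiveSide, hopp, hv, hv.le]

namespace WeightedGraph

/-- The labels whose signs two-colour a bipartite graph. -/
def signedLabels (x : WeightedGraph) : Fin x.numVertices → ℝ :=
  x.arcs.foldl mergeAlong (initialLabels _)

theorem isSelector_signedLabels {x : WeightedGraph} (hx : x.graph.IsBipartite) :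
    x.IsSelector true (positiveSide x.signedLabels) := by
  have χ : x.graph.Coloring Bool := hx.toColoring (by simp)
  exact ((isSignedLabelling_initialLabels χ).append
    fun e he => χ.valid (x.mem_arcs.1 he)).isSelector_positiveSide

theorem isSelector_false (x : WeightedGraph) : x.IsSelector false (positiveSide 0) := by
  simp [IsSelector, positiveSide]

end WeightedGraph

/-! ### Deterministic computations -/

attribute [simp] Store.setReg Store.setRReg Store.setMem Store.setNats Store.setReals

/-- Effect of a deterministic operation; coin flips and oracle calls are given no effect. -/
@[simp]
def Op.eff (s : Store) : Op → Store
  | .zero i => s.setReg i 0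
  | .succ i => s.setReg i (s.reg i + 1)
  | .pred i => s.setReg i (s.reg i - 1)
  | .copy i j => s.setReg i (s.reg j)
  | .len i a => s.setReg i (s.mem a).nats.length
  | .load i a j => s.setReg i ((s.mem a).nats.getD (s.reg j) 0)
  | .store a j i => s.setNats a ((s.mem a).nats.set (s.reg j) (s.reg i))
  | .push a i => s.setNats a ((s.mem a).nats ++ [s.reg i])
  | .rzero i => s.setRReg i 0
  | .rone i => s.setRReg i 1
  | .rcopy i j => s.setRReg i (s.rreg j)
  | .radd i j k => s.setRReg i (s.rreg j + s.rreg k)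
  | .rsub i j k => s.setRReg i (s.rreg j - s.rreg k)
  | .rmul i j k => s.setRReg i (s.rreg j * s.rreg k)
  | .rdiv i j k => s.setRReg i (s.rreg j / s.rreg k)
  | .rlen i a => s.setReg i (s.mem a).reals.length
  | .rload i a j => s.setRReg i ((s.mem a).reals.getD (s.reg j) 0)
  | .rstore a j i => s.setReals a ((s.mem a).reals.set (s.reg j) (s.rreg i))
  | .rpush a i => s.setReals a ((s.mem a).reals ++ [s.rreg i])
  | .clear a => s.setMem a ⟨[], []⟩
  | .flip _ => s
  | .query _ => s

/-- The operations that neither flip a coin nor call the oracle. -/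
@[simp]
def Op.IsDet : Op → Prop
  | .flip _ | .query _ => False
  | _ => True

theorem Op.IsDet.exec_eq {o : Op} (h : o.IsDet) (M : RandomizedMap) (s : Store) :
    o.exec M s = PMF.pure (o.eff s) := by
  cases o <;> first | rfl | exact h.elim

/-- `SilentPath n c c'`: whatever the oracle, the machine moves from `c` to `c'` in `n` steps,
without coin flips and oracle calls. -/
inductive Config.SilentPath : ℕ → Config → Config → Prop
  | refl (c : Config) : SilentPath 0 c c
  | cons {n : ℕ} {p : Prog} {K : List Prog} {s : Store} {c c' : Config}
      (hp : ∀ i, p ≠ .op (.query i)) (hstep : ∀ M, Config.step M ⟨p :: K, s⟩ = PMF.pure c)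
      (h : SilentPath n c c') : SilentPath (n + 1) ⟨p :: K, s⟩ c'

namespace Config

theorem SilentPath.trans {m n : ℕ} {a b c : Config} (h : SilentPath m a b)
    (h' : SilentPath n b c) : SilentPath (m + n) a c := by
  induction h with
  | refl => simpa using h'
  | cons hp hstep _ ih =>
    rw [Nat.add_right_comm]
    exact .cons hp hstep (ih h')

theorem SilentPath.run_add {n : ℕ} {c c' : Config} (h : SilentPath n c c') (M : RandomizedMap)
    (m : ℕ) : run M (n + m) c = run M m c' := by
  induction h with
  | refl => simp
  | cons _ hstep _ ih => rw [Nat.add_right_comm, run, hstep, PMF.pure_bind, ih]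

theorem SilentPath.todo_ne_query {n : ℕ} {c c' : Config} (h : SilentPath n c c')
    {M : RandomizedMap} {t : ℕ} (ht : t < n) {e : Config} (he : e ∈ (run M t c).support) (i : ℕ)
    (K : List Prog) : e.todo ≠ .op (.query i) :: K := by
  induction h generalizing t with
  | refl => omega
  | cons hp hstep _ ih =>
    cases t with
    | zero =>
      rw [run, PMF.support_pure, Set.mem_singleton_iff] at he
      simp [he, hp]
    | succ t =>
      rw [run, hstep, PMF.pure_bind] at he
      exact ih (by omega) he

theorem run_halted (M : RandomizedMap) (n : ℕ) (s : Store) :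
    run M n ⟨[], s⟩ = PMF.pure ⟨[], s⟩ := by
  induction n with
  | zero => rfl
  | succ n ih => rw [run, step, PMF.pure_bind, ih]

end Config

/-- Started in the store `s`, the program `p` terminates within `T` steps in a store satisfying `Q`,
without coin flips and oracle calls. -/
def Prog.Ensures (p : Prog) (s : Store) (T : ℕ) (Q : Store → Prop) : Prop :=
  ∃ s', Q s' ∧ ∃ t ≤ T, ∀ K, Config.SilentPath t ⟨p :: K, s⟩ ⟨K, s'⟩

namespace Prog

variable {p q : Prog} {s : Store} {T T' : ℕ} {Q R : Store → Prop}

theorem Ensures.mono (h : p.Ensures s T R) (hT : T ≤ T') (hQ : ∀ s, R s → Q s) :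
    p.Ensures s T' Q := by
  obtain ⟨s', hs, t, ht, hp⟩ := h
  exact ⟨s', hQ _ hs, t, ht.trans hT, hp⟩

theorem ensures_skip (h : Q s) : skip.Ensures s 1 Q :=
  ⟨s, h, 1, le_rfl, fun _ => .cons nofun (fun _ => rfl) (.refl _)⟩

theorem ensures_op {o : Op} (ho : o.IsDet) (h : Q (o.eff s)) : (op o).Ensures s 1 Q := by
  refine ⟨_, h, 1, le_rfl, fun K => .cons ?_ (fun M => ?_) (.refl _)⟩
  · rintro i ⟨⟩
    exact ho
  · simp only [Config.step, ho.exec_eq, PMF.pure_map]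

theorem Ensures.seq (h : p.Ensures s T R) (h' : ∀ s', R s' → q.Ensures s' T' Q) :
    (seq p q).Ensures s (T + T' + 1) Q := by
  obtain ⟨s₁, h₁, t₁, ht₁, hp₁⟩ := h
  obtain ⟨s₂, h₂, t₂, ht₂, hp₂⟩ := h' _ h₁
  exact ⟨s₂, h₂, t₁ + t₂ + 1, by omega, fun K =>
    .cons nofun (fun _ => rfl) ((hp₁ _).trans (hp₂ _))⟩

theorem ensures_ite {t : Test} (hp : t.holds s → p.Ensures s T Q)
    (hq : ¬ t.holds s → q.Ensures s T Q) : (ite t p q).Ensures s (T + 1) Q := by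
  by_cases ht : t.holds s
  · obtain ⟨s', h, n, hn, hpath⟩ := hp ht
    exact ⟨s', h, n + 1, by omega, fun K =>
      .cons nofun (fun _ => by simp [Config.step, ht]) (hpath K)⟩
  · obtain ⟨s', h, n, hn, hpath⟩ := hq ht
    exact ⟨s', h, n + 1, by omega, fun K =>
      .cons nofun (fun _ => by simp [Config.step, ht]) (hpath K)⟩

theorem ensures_while {t : Test} {N : ℕ} {I : ℕ → Store → Prop}
    (hI : ∀ k < N, ∀ s, I k s → t.holds s ∧ p.Ensures s T (I (k + 1)))
    (hN : ∀ s, I N s → ¬ t.holds s) (hs : I 0 s) :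
    (Prog.while t p).Ensures s (N * (T + 1) + 1) (I N) := by
  suffices h : ∀ m k, k + m = N → ∀ s, I k s →
      (Prog.while t p).Ensures s (m * (T + 1) + 1) (I N) from h N 0 (by omega) s hs
  intro m
  induction m with
  | zero =>
    rintro k rfl s hs
    exact ⟨s, hs, 1, by omega, fun K =>
      .cons nofun (fun _ => by simp [Config.step, hN s hs]) (.refl _)⟩
  | succ m ih =>
    intro k hk s hs
    obtain ⟨ht, s₁, h₁, t₁, ht₁, hp₁⟩ := hI k (by omega) s hs
    obtain ⟨s₂, h₂, t₂, ht₂, hp₂⟩ := ih (k + 1) (by omega) s₁ h₁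
    exact ⟨s₂, h₂, t₁ + t₂ + 1, by rw [Nat.succ_mul]; omega, fun K =>
      .cons nofun (fun _ => by simp [Config.step, ht]) ((hp₁ _).trans (hp₂ _))⟩

/-- The straight-line program that executes the listed operations. -/
def block : List Op → Prog
  | [] => skip
  | o :: l => seq (op o) (block l)

theorem ensures_block {l : List Op} (hl : ∀ o ∈ l, o.IsDet) (h : Q (l.foldl Op.eff s)) :
    (block l).Ensures s (2 * l.length + 1) Q := by
  induction l generalizing s with
  | nil => exact ensures_skip h
  | cons o l ih =>
    rw [List.forall_mem_cons] at hl
    refine ((ensures_op (Q := (· = o.eff s)) hl.1 rfl).seq (T' := 2 * l.length + 1)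
      (Q := Q) ?_).mono (by rw [List.length_cons]; omega) fun _ h => h
    rintro _ rfl
    exact ih hl.2 h

/-- `for i = 0, …, b - 1 do p`, the bound being read from the register `b` before each turn. -/
def forRange (i b : ℕ) (p : Prog) : Prog :=
  .seq (.op (.zero i)) (.while (.lt i b) (.seq p (.op (.succ i))))

theorem ensures_forRange {i b N : ℕ} {I : ℕ → Store → Prop}
    (hI : ∀ k s v, I k s → I k (s.setReg i v)) (hb : ∀ k s, I k s → s.reg b = N)
    (hp : ∀ k < N, ∀ s, I k s → s.reg i = k →
      p.Ensures s T fun s' => I (k + 1) s' ∧ s'.reg i = k) (h0 : I 0 s) :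
    (forRange i b p).Ensures s (N * (T + 3) + 3) (I N) := by
  have hinit : (op (.zero i)).Ensures s 1 fun s' => I 0 s' ∧ s'.reg i = 0 :=
    ensures_op trivial ⟨hI 0 s 0 h0, by simp [Store.setReg]⟩
  refine (hinit.seq (T' := N * (T + 3) + 1) fun s hs => (ensures_while
    (I := fun k s' => I k s' ∧ s'.reg i = k) (T := T + 2) (fun k hk s hs => ⟨?_, ?_⟩)
    (fun s hs => ?_) hs).mono le_rfl fun _ h => h.1).mono (by omega) fun _ h => h
  · simpa only [Test.holds, hs.2, hb k s hs.1]
  · exact (hp k hk s hs.1 hs.2).seq fun s' hs' =>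
      ensures_op trivial ⟨hI _ _ _ hs'.1, by simp [Store.setReg, hs'.2]⟩
  · simp only [Test.holds, hs.2, hb N s hs.1, lt_irrefl, not_false_eq_true]

/-- Prepare a query, call the oracle with the tolerance in real register `0`, process the answer. -/
def singleQuery (p q : Prog) : Prog := .seq p (.seq (.op (.query 0)) q)

/-- On input `(d, ε)`, the program `singleQuery p q` calls the oracle on `(w, ε)` and turns an
answer `a` into the output `out a`; this takes at most `T` steps before and `T'` steps after the
call. -/
def QueriesOnce (p q : Prog) (d : Word) (ε : ℝ) (T T' : ℕ) (w : Word) (out : Word → Word) : Prop :=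
  p.Ensures (p.start d ε).store T fun s => s.mem 1 = w ∧ s.rreg 0 = ε ∧
    ∀ a, q.Ensures (s.setMem 2 a) T' fun s' => s'.mem 3 = out a

namespace QueriesOnce

variable {d w : Word} {ε : ℝ} {out : Word → Word} {M : RandomizedMap}

theorem exists_silentPath (h : QueriesOnce p q d ε T T' w out) :
    ∃ (s : Store) (t : ℕ), t ≤ T + 2 ∧ s.mem 1 = w ∧ s.rreg 0 = ε ∧
      Config.SilentPath t ((singleQuery p q).start d ε) ⟨[.op (.query 0), q], s⟩ ∧
      ∀ a, ∃ (s' : Store) (t' : ℕ), t' ≤ T' ∧ s'.mem 3 = out a ∧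
        Config.SilentPath t' ⟨[q], s.setMem 2 a⟩ ⟨[], s'⟩ := by
  obtain ⟨s, ⟨hw, hε, hq⟩, t, ht, hp⟩ := h
  refine ⟨s, t + 1 + 1, by omega, hw, hε, ?_, fun a => ?_⟩
  · exact .cons nofun (fun _ => rfl) ((hp _).trans (.cons nofun (fun _ => rfl) (.refl _)))
  · obtain ⟨s', h, t', ht', hp'⟩ := hq a
    exact ⟨s', t', ht', h, hp' _⟩

theorem run_eq (h : QueriesOnce p q d ε T T' w out) {n : ℕ} (hn : T + T' + 3 ≤ n) :
    ∃ f : Word → Store, (∀ a, (f a).mem 3 = out a) ∧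
      ((singleQuery p q).start d ε).run M n = (M w ε).map fun a => ⟨[], f a⟩ := by
  obtain ⟨s, t, ht, hw, hε, hpath, hq⟩ := h.exists_silentPath
  choose f t' ht' hf hpath' using hq
  refine ⟨f, hf, ?_⟩
  obtain ⟨m, rfl⟩ : ∃ m, n = t + (m + 1) := ⟨n - t - 1, by omega⟩
  rw [hpath.run_add, Config.run]
  simp only [Config.step, Op.exec, hw, hε, PMF.map_comp]
  rw [PMF.bind_map, ← PMF.bind_pure_comp]
  congr 1
  funext a
  obtain ⟨m', rfl⟩ : ∃ m', m = t' a + m' := ⟨m - t' a, by have := ht' a; omega⟩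
  exact ((hpath' a).run_add M m').trans (Config.run_halted M m' (f a))

theorem eq_of_todo_eq_query (h : QueriesOnce p q d ε T T' w out) {n : ℕ} {c : Config}
    (hc : c ∈ (((singleQuery p q).start d ε).run M n).support) {i : ℕ} {K : List Prog}
    (hK : c.todo = .op (.query i) :: K) : c.store.mem 1 = w ∧ c.store.rreg i = ε := by
  obtain ⟨s, t, -, hw, hε, hpath, hq⟩ := h.exists_silentPath
  rcases lt_or_ge n t with hn | hn
  · exact absurd hK (hpath.todo_ne_query hn hc i K)
  obtain ⟨m, rfl⟩ := Nat.exists_eq_add_of_le hn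
  rw [hpath.run_add] at hc
  cases m with
  | zero =>
    rw [Config.run, PMF.support_pure, Set.mem_singleton_iff] at hc
    subst hc
    simp only [List.cons.injEq, op.injEq, Op.query.injEq] at hK
    exact ⟨hw, hK.1 ▸ hε⟩
  | succ m =>
    simp only [Config.run, Config.step, Op.exec, PMF.map_comp, PMF.bind_map] at hc
    obtain ⟨a, -, hc⟩ := (PMF.mem_support_bind_iff _ _ _).1 hc
    obtain ⟨s', t', -, -, hpath'⟩ := hq a
    rcases lt_or_ge m t' with hm | hm
    · exact absurd hK (hpath'.todo_ne_query hm hc i K)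
    obtain ⟨m', rfl⟩ := Nat.exists_eq_add_of_le hm
    simp only [Function.comp_apply] at hc
    rw [hpath'.run_add, Config.run_halted, PMF.support_pure, Set.mem_singleton_iff] at hc
    subst hc
    cases hK

end QueriesOnce

end Prog

theorem aptReduces_of_queriesOnce {P Q : MaxProblem} {p q : Prog} {f : P.Inst → Q.Inst}
    {out : P.Inst → Word → Word} (b k : ℕ)
    (hprog : ∀ x ε, ∃ T T' : ℕ, T + T' + 3 ≤ b * ((P.encInst x).size + 1) ^ k ∧
      Prog.QueriesOnce p q (P.encInst x) ε T T' (Q.encInst (f x)) (out x))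
    (hout : ∀ x (ε : ℝ), 0 < ε → ε < 1 → ∀ y, Q.IsApprox ((2 : ℝ) ^ ε) (f x) y →
      ∃ z, P.encSol x z = out x (Q.encSol (f x) y) ∧ P.IsApprox ((2 : ℝ) ^ ε) x z) :
    APTReduces P Q := by
  let B : MvPolynomial (Fin 2) ℝ := MvPolynomial.C (b : ℝ) * (MvPolynomial.X 0 + 1) ^ k
  have hB : ∀ d ε, polyBound B d ε = ((b * (d.size + 1) ^ k : ℕ) : ℝ) := by
    simp [B, polyBound]
  refine ⟨.singleQuery p q, MvPolynomial.X 1, B, fun M hM => ⟨?_, ?_, ?_⟩⟩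
  · intro x ε h0 h1
    obtain ⟨T, T', hT, hquery⟩ := hprog x ε
    obtain ⟨g, hg, hrun⟩ := hquery.run_eq (M := M) hT
    rw [Prog.outcome, hB, Nat.floor_natCast, hrun, PMF.map_comp, PMF.toOuterMeasure_map_apply]
    refine (hM (f x) ε h0 h1).trans (MeasureTheory.OuterMeasure.mono _ ?_)
    rintro _ ⟨y, rfl, hy⟩
    obtain ⟨z, hz, hz'⟩ := hout x ε h0 h1 y hy
    exact ⟨z, hz.trans (hg _).symm, hz'⟩
  · intro x ε h0 h1 t c hc i K hK
    obtain ⟨T, T', -, hquery⟩ := hprog x ε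
    obtain ⟨hw, hε⟩ := hquery.eq_of_todo_eq_query hc hK
    exact ⟨⟨f x, hw.symm⟩, by rwa [hε], by rwa [hε], by simp [hε, polyBound]⟩
  · intro x ε _ _
    obtain ⟨T, T', hT, hquery⟩ := hprog x ε
    obtain ⟨g, -, hrun⟩ := hquery.run_eq (M := M) hT
    refine ⟨by rw [hB]; positivity, fun c hc => ?_⟩
    rw [hB, Nat.floor_natCast, hrun, PMF.support_map] at hc
    obtain ⟨a, -, rfl⟩ := hc
    rfl

/-! ### Programs on graphs -/

theorem take_succ_finRange {n : ℕ} (i : Fin n) :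
    (List.finRange n).take (i + 1) = (List.finRange n).take i ++ [i] := by
  rw [List.take_add_one, List.getElem?_eq_getElem (by simp), List.getElem_finRange]
  rfl

namespace WeightedGraph

variable {x : WeightedGraph} {ε : ℝ} {s : Store} {T : ℕ}

/-- The bookkeeping common to all programs on graphs: the input is available, with the number of
vertices and the number of entries of the adjacency matrix in the registers `0` and `1`. -/
structure Loaded (x : WeightedGraph) (ε : ℝ) (s : Store) : Prop where
  reg_zero : s.reg 0 = x.numVertices
  reg_one : s.reg 1 = x.numVertices * x.numVertices
  rreg_zero : s.rreg 0 = ε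
  mem_zero : s.mem 0 = x.enc

/-- A loop treats the vertex `u`. -/
structure AtVertex (x : WeightedGraph) (ε : ℝ) (u : Fin x.numVertices) (s : Store) : Prop
    extends Loaded x ε s where
  reg_two : s.reg 2 = u

/-- A loop treats the entry of the adjacency matrix at position `e`. -/
structure AtEntry (x : WeightedGraph) (ε : ℝ) (e : Fin x.numVertices × Fin x.numVertices)
    (s : Store) : Prop extends Loaded x ε s where
  reg_two : s.reg 2 = e.1
  reg_three : s.reg 3 = e.2
  reg_four : s.reg 4 = finProdFinEquiv e

/-- Run `body` at each vertex, which is held in register `2`. -/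
def forVertices (body : Prog) : Prog := .forRange 2 0 body

theorem ensures_forVertices {body : Prog} {J : ℕ → (ℕ → Word) → Prop}
    (hbody : ∀ u s, AtVertex x ε u s → J u s.mem →
      body.Ensures s T fun s' => AtVertex x ε u s' ∧ J (u + 1) s'.mem)
    (hs : Loaded x ε s) (h0 : J 0 s.mem) :
    (forVertices body).Ensures s (x.numVertices * (T + 3) + 3) fun s' =>
      Loaded x ε s' ∧ J x.numVertices s'.mem := by
  refine Prog.ensures_forRange (I := fun k s => Loaded x ε s ∧ J k s.mem) ?_
    (fun k s h => h.1.reg_zero) (fun k hk s h hk' => ?_) ⟨hs, h0⟩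
  · rintro k s v ⟨⟨h0, h1, hε, hd⟩, hJ⟩
    exact ⟨⟨by simpa, by simpa, hε, hd⟩, hJ⟩
  · exact (hbody ⟨k, hk⟩ s ⟨h.1, hk'⟩ h.2).mono le_rfl fun s' h' =>
      ⟨⟨h'.1.toLoaded, h'.2⟩, h'.1.reg_two⟩

theorem enc_nats_getD_finProdFinEquiv (e : Fin x.numVertices × Fin x.numVertices)
    [Decidable (x.graph.Adj e.1 e.2)] :
    x.enc.nats.getD (finProdFinEquiv e + 1) 0 = if x.graph.Adj e.1 e.2 then 1 else 0 := by
  have hlt := (finProdFinEquiv e).isLt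
  have hdiv : (finProdFinEquiv e).divNat = e.1 :=
    congrArg Prod.fst (finProdFinEquiv.symm_apply_apply e)
  have hmod : (finProdFinEquiv e).modNat = e.2 :=
    congrArg Prod.snd (finProdFinEquiv.symm_apply_apply e)
  simp only [enc, List.getD_cons_succ]
  rw [List.getD_eq_getElem _ _ (by simpa using hlt), List.getElem_ofFn]
  simp only [Fin.eta, hdiv, hmod]

theorem enc_reals_getD (u : Fin x.numVertices) : x.enc.reals.getD u 0 = x.weight u := by
  simp [enc]

open Classical in
theorem arcsBefore_succ (e : Fin x.numVertices × Fin x.numVertices) :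
    x.arcsBefore (finProdFinEquiv e + 1) =
      x.arcsBefore (finProdFinEquiv e) ++ if x.graph.Adj e.1 e.2 then [e] else [] := by
  rw [arcsBefore, take_succ_finRange, List.map_append, List.filter_append]
  simp [arcsBefore, List.filter_singleton, -finProdFinEquiv_symm_apply]

/-- Run `body` if the entry of the adjacency matrix at the position in register `4` is nonzero. In
the encoding of a graph, the matrix is preceded by the number of vertices. -/
def visitEntry (body : Prog) : Prog :=
  .seq (.block [.zero 6, .copy 7 4, .succ 7, .load 7 0 7]) (.ite (.lt 6 7) body .skip)

theorem ensures_visitEntry {body : Prog}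
    {J : List (Fin x.numVertices × Fin x.numVertices) → (ℕ → Word) → Prop}
    {e : Fin x.numVertices × Fin x.numVertices}
    (hbody : ∀ L s, AtEntry x ε e s → J L s.mem →
      body.Ensures s T fun s' => AtEntry x ε e s' ∧ J (L ++ [e]) s'.mem)
    (hs : AtEntry x ε e s) (hJ : J (x.arcsBefore (finProdFinEquiv e)) s.mem) :
    (visitEntry body).Ensures s (T + 12) fun s' =>
      AtEntry x ε e s' ∧ J (x.arcsBefore (finProdFinEquiv e + 1)) s'.mem := by
  classical
  have hload : (Prog.block [.zero 6, .copy 7 4, .succ 7, .load 7 0 7]).Ensures s 9 fun s' =>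
      (AtEntry x ε e s' ∧ J (x.arcsBefore (finProdFinEquiv e)) s'.mem) ∧
        s'.reg 6 = 0 ∧ s'.reg 7 = if x.graph.Adj e.1 e.2 then 1 else 0 := by
    refine Prog.ensures_block (by simp) ⟨⟨⟨⟨?_, ?_, ?_, ?_⟩, ?_, ?_, ?_⟩, ?_⟩, ?_, ?_⟩ <;>
      simp [hs.reg_zero, hs.reg_one, hs.rreg_zero, hs.mem_zero, hs.reg_two, hs.reg_three,
        hs.reg_four, hJ, enc_nats_getD_finProdFinEquiv, -finProdFinEquiv_apply_val,
        -List.getD_eq_getElem?_getD]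
  refine (hload.seq (T' := T + 2) fun s' hs' => Prog.ensures_ite (fun h => ?_)
    fun h => ?_).mono (by omega) fun _ h => h
  all_goals
    obtain ⟨⟨hs', hJ'⟩, h6, h7⟩ := hs'
    rw [Test.holds, h6, h7] at h
    rw [arcsBefore_succ]
  · rw [if_pos (by_contra fun hadj => by simp [hadj] at h)]
    exact (hbody _ _ hs' hJ').mono (by omega) fun _ h => h
  · rw [if_neg fun hadj => by simp [hadj] at h, List.append_nil]
    exact (Prog.ensures_skip ⟨hs', hJ'⟩).mono (by omega) fun _ h => h

/-- Move the row and column counters to the next entry of the adjacency matrix. -/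
def advanceEntry : Prog :=
  .seq (.op (.succ 3)) (.ite (.eq 3 0) (.block [.zero 3, .succ 2]) .skip)

theorem ensures_advanceEntry {e : Fin x.numVertices × Fin x.numVertices} (hs : AtEntry x ε e s) :
    advanceEntry.Ensures s 8 fun s' =>
      Loaded x ε s' ∧ s'.reg 2 = (finProdFinEquiv e + 1) / x.numVertices ∧
        s'.reg 3 = (finProdFinEquiv e + 1) % x.numVertices ∧
        s'.reg 4 = finProdFinEquiv e ∧ s'.mem = s.mem := by
  have hcount : (Prog.op (.succ 3)).Ensures s 1 fun s' =>
      Loaded x ε s' ∧ s'.reg 2 = e.1 ∧ s'.reg 3 = e.2 + 1 ∧ s'.reg 4 = finProdFinEquiv e ∧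
        s'.mem = s.mem := by
    refine Prog.ensures_op trivial ⟨⟨?_, ?_, ?_, ?_⟩, ?_, ?_, ?_, ?_⟩ <;>
      simp [hs.reg_zero, hs.reg_one, hs.rreg_zero, hs.mem_zero, hs.reg_two, hs.reg_three,
        hs.reg_four]
  have hpos : 0 < x.numVertices := e.2.pos
  refine hcount.seq fun s' ⟨hs', h2, h3, h4, hmem⟩ => Prog.ensures_ite (T := 5) (fun h => ?_)
    fun h => ?_
  all_goals rw [Test.holds, h3, hs'.reg_zero] at h
  · obtain ⟨hdiv, hmod⟩ := (Nat.div_mod_unique hpos (a := finProdFinEquiv e + 1)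
      (c := 0) (d := e.1 + 1)).2 ⟨by rw [finProdFinEquiv_apply_val, mul_add]; omega, hpos⟩
    rw [hdiv, hmod]
    refine Prog.ensures_block (by simp) ⟨⟨?_, ?_, ?_, ?_⟩, ?_, ?_, ?_, ?_⟩ <;>
      simp [hs'.reg_zero, hs'.reg_one, hs'.rreg_zero, hs'.mem_zero, h2, h4, ← hmem]
  · obtain ⟨hdiv, hmod⟩ := (Nat.div_mod_unique hpos (a := finProdFinEquiv e + 1)
      (c := e.2 + 1) (d := e.1)).2 ⟨by rw [finProdFinEquiv_apply_val]; omega, by omega⟩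
    rw [hdiv, hmod]
    exact (Prog.ensures_skip ⟨hs', h2, h3, h4, hmem⟩).mono (by omega) fun _ h => h

/-- Run `body` at each nonzero entry of the adjacency matrix. The row and the column are counted in
the registers `2` and `3`, since the machine cannot divide the position in register `4`. -/
def forArcs (body : Prog) : Prog :=
  .seq (.block [.zero 2, .zero 3]) (.forRange 4 1 (.seq (visitEntry body) advanceEntry))

theorem ensures_forArcs {body : Prog}
    {J : List (Fin x.numVertices × Fin x.numVertices) → (ℕ → Word) → Prop}
    (hbody : ∀ L e s, AtEntry x ε e s → J L s.mem →
      body.Ensures s T fun s' => AtEntry x ε e s' ∧ J (L ++ [e]) s'.mem)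
    (hs : Loaded x ε s) (h0 : J [] s.mem) :
    (forArcs body).Ensures s (x.numVertices * x.numVertices * (T + 24) + 9) fun s' =>
      Loaded x ε s' ∧ J x.arcs s'.mem := by
  have hinit : (Prog.block [.zero 2, .zero 3]).Ensures s 5 fun s' =>
      Loaded x ε s' ∧ s'.reg 2 = 0 ∧ s'.reg 3 = 0 ∧ J (x.arcsBefore 0) s'.mem := by
    refine Prog.ensures_block (by simp) ⟨⟨?_, ?_, ?_, ?_⟩, ?_, ?_, ?_⟩ <;>
      simp [hs.reg_zero, hs.reg_one, hs.rreg_zero, hs.mem_zero, h0, arcsBefore]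
  refine (hinit.seq (T' := x.numVertices * x.numVertices * (T + 24) + 3) fun s' hs' =>
    (Prog.ensures_forRange (N := x.numVertices * x.numVertices) (T := T + 21)
      (I := fun k s => (Loaded x ε s ∧ s.reg 2 = k / x.numVertices ∧
        s.reg 3 = k % x.numVertices) ∧ J (x.arcsBefore k) s.mem)
      ?_ (fun k s h => h.1.1.reg_one) (fun k hk s h hk' => ?_) ?_).mono le_rfl
        fun s h => ⟨h.1.1, h.2⟩).mono (by omega) fun _ h => h
  · rintro k s v ⟨⟨⟨h0, h1, hε, hd⟩, h2, h3⟩, hJ⟩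
    exact ⟨⟨⟨by simpa, by simpa, hε, hd⟩, by simpa, by simpa⟩, hJ⟩
  · obtain ⟨e, he⟩ : ∃ e, finProdFinEquiv e = (⟨k, hk⟩ : Fin _) := finProdFinEquiv.surjective _
    obtain rfl : k = finProdFinEquiv e := congrArg Fin.val he.symm
    have hpos : 0 < x.numVertices := e.2.pos
    obtain ⟨hdiv, hmod⟩ := (Nat.div_mod_unique hpos (a := finProdFinEquiv e)
      (c := e.2) (d := e.1)).2 ⟨(finProdFinEquiv_apply_val e).symm, e.2.isLt⟩
    rw [hdiv, hmod] at h
    exact (ensures_visitEntry (hbody · e) ⟨h.1.1, h.1.2.1, h.1.2.2, hk'⟩ h.2).seq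
      fun s' hs' => (ensures_advanceEntry hs'.1).mono le_rfl fun s'' h' =>
        ⟨⟨⟨h'.1, h'.2.1, h'.2.2.1⟩, h'.2.2.2.2 ▸ hs'.2⟩, h'.2.2.2.1⟩
  · exact ⟨⟨hs'.1, by simp [hs'.2.1], by simp [hs'.2.2.1]⟩, hs'.2.2.2⟩

end WeightedGraph

/-! ### The labelling programs -/

/-- The real part of array `4` contains the labels `ℓ`, where missing entries count as `0`. -/
def HasLabels {n : ℕ} (ℓ : Fin n → ℝ) (m : ℕ → Word) : Prop :=
  ∀ u : Fin n, (m 4).reals.getD u 0 = ℓ u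

theorem hasLabels_of_eq {n : ℕ} {ℓ : Fin n → ℝ} {m : ℕ → Word}
    (h : m 4 = ⟨[], List.ofFn ℓ⟩) : HasLabels ℓ m := by
  intro u
  simp [h]

theorem set_ofFn {α : Type*} {n : ℕ} (f : Fin n → α) (i : Fin n) (a : α) :
    (List.ofFn f).set i a = List.ofFn (Function.update f i a) := by
  refine List.ext_getElem (by simp) fun j hj _ => ?_
  simp only [List.getElem_set, List.getElem_ofFn, Function.update_apply, Fin.ext_iff]
  grind

theorem ofFn_initialLabels_succ (n : ℕ) :
    List.ofFn (initialLabels (n + 1)) =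
      List.ofFn (initialLabels n) ++ [(List.ofFn (initialLabels n)).getD (n - 1) 0 + 1] := by
  rw [List.ofFn_succ_last]
  cases n with
  | zero => simp [initialLabels]
  | succ n => simp [initialLabels, -List.ofFn_succ, funext_iff]

namespace WeightedGraph

variable {x : WeightedGraph} {ε : ℝ} {s : Store}

/-- Append `1` plus the preceding label; for the first vertex the machine reads `0` instead. -/
def pushLabel : Prog :=
  .block [.copy 5 2, .pred 5, .rload 1 4 5, .rone 2, .radd 1 1 2, .rpush 4 1]

theorem ensures_pushLabel {u : Fin x.numVertices} (hs : AtVertex x ε u s)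
    (hmem : s.mem 4 = ⟨[], List.ofFn (initialLabels u)⟩) :
    pushLabel.Ensures s 13 fun s' =>
      AtVertex x ε u s' ∧ s'.mem 4 = ⟨[], List.ofFn (initialLabels (u + 1))⟩ := by
  refine Prog.ensures_block (by simp) ⟨⟨⟨?_, ?_, ?_, ?_⟩, ?_⟩, ?_⟩ <;>
    simp [hs.reg_zero, hs.reg_one, hs.rreg_zero, hs.mem_zero, hs.reg_two, hmem,
      ofFn_initialLabels_succ, -List.ofFn_succ, -List.getD_eq_getElem?_getD]

/-- The state of the machine while it merges the labels at the two ends of the arc `e`. -/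
structure Merging (x : WeightedGraph) (ε : ℝ) (e : Fin x.numVertices × Fin x.numVertices)
    (ℓ : Fin x.numVertices → ℝ) (s : Store) : Prop extends AtEntry x ε e s where
  rreg_two : s.rreg 2 = ℓ e.1
  rreg_three : s.rreg 3 = ℓ e.2
  rreg_four : s.rreg 4 = -ℓ e.1
  rreg_five : s.rreg 5 = -ℓ e.2

/-- The step of `mergeAlong` at the vertex in register `5`. The label is overwritten in place, so
the labels at the ends of the arc have to be kept in registers, see `Merging`. -/
def mergeVertex : Prog :=
  .seq (.op (.rload 6 4 5))
    (.seq (.ite (.req 6 3) (.op (.rcopy 6 4)) (.ite (.req 6 5) (.op (.rcopy 6 2)) .skip))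
      (.op (.rstore 4 5 6)))

theorem ensures_mergeVertex {e : Fin x.numVertices × Fin x.numVertices}
    {ℓ f : Fin x.numVertices → ℝ} {w : Fin x.numVertices} (hs : Merging x ε e ℓ s)
    (hw : s.reg 5 = w) (hmem : s.mem 4 = ⟨[], List.ofFn f⟩) (hf : f w = ℓ w) :
    mergeVertex.Ensures s 7 fun s' => (Merging x ε e ℓ s' ∧
      s'.mem 4 = ⟨[], List.ofFn (Function.update f w (mergeAlong ℓ e w))⟩) ∧ s'.reg 5 = w := by
  have hload : (Prog.op (.rload 6 4 5)).Ensures s 1 (· = s.setRReg 6 (ℓ w)) :=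
    Prog.ensures_op trivial (by simp [hw, hmem, hf])
  have hmerge : (Prog.ite (.req 6 3) (.op (.rcopy 6 4)) (.ite (.req 6 5) (.op (.rcopy 6 2)) .skip)
      ).Ensures (s.setRReg 6 (ℓ w)) 3 (· = s.setRReg 6 (mergeAlong ℓ e w)) := by
    refine Prog.ensures_ite (fun h => ?_) fun h => Prog.ensures_ite (fun h' => ?_) fun h' => ?_
    all_goals replace h := by simpa [Test.holds, hs.rreg_three] using h
    · have hlabel : mergeAlong ℓ e w = -ℓ e.1 := if_pos h
      exact (Prog.ensures_op (by simp) (by simp [hlabel, hs.rreg_four])).mono (by omega)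
        fun _ h => h
    all_goals replace h' := by simpa [Test.holds, hs.rreg_five] using h'
    · have hlabel : mergeAlong ℓ e w = ℓ e.1 := (if_neg h).trans (if_pos h')
      exact Prog.ensures_op (by simp) (by simp [hlabel, hs.rreg_two])
    · have hlabel : mergeAlong ℓ e w = ℓ w := (if_neg h).trans (if_neg h')
      exact Prog.ensures_skip (by rw [hlabel])
  refine hload.seq (T' := 5) fun _ hs₁ => hs₁ ▸ hmerge.seq (T' := 1) fun _ hs₂ => hs₂ ▸ ?_
  refine Prog.ensures_op trivial ⟨⟨⟨⟨⟨?_, ?_, ?_, ?_⟩, ?_, ?_, ?_⟩, ?_, ?_, ?_, ?_⟩, ?_⟩, ?_⟩ <;>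
    simp [hs.reg_zero, hs.reg_one, hs.rreg_zero, hs.mem_zero, hs.reg_two, hs.reg_three,
      hs.reg_four, hs.rreg_two, hs.rreg_three, hs.rreg_four, hs.rreg_five, hw, hmem, set_ofFn]

/-- Implementation of `mergeAlong` on the array `4`. -/
def mergeArc : Prog :=
  .seq (.block [.rload 2 4 2, .rload 3 4 3, .rzero 1, .rsub 4 1 2, .rsub 5 1 3])
    (.forRange 5 0 mergeVertex)

theorem ensures_mergeArc {e : Fin x.numVertices × Fin x.numVertices}
    {ℓ : Fin x.numVertices → ℝ} (hs : AtEntry x ε e s) (hmem : s.mem 4 = ⟨[], List.ofFn ℓ⟩) :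
    mergeArc.Ensures s (10 * x.numVertices + 15) fun s' =>
      AtEntry x ε e s' ∧ s'.mem 4 = ⟨[], List.ofFn (mergeAlong ℓ e)⟩ := by
  have hinit : (Prog.block [.rload 2 4 2, .rload 3 4 3, .rzero 1, .rsub 4 1 2, .rsub 5 1 3]).Ensures
      s 11 fun s' => Merging x ε e ℓ s' ∧ s'.mem 4 = ⟨[], List.ofFn ℓ⟩ := by
    refine Prog.ensures_block (by simp) ⟨⟨⟨⟨?_, ?_, ?_, ?_⟩, ?_, ?_, ?_⟩, ?_, ?_, ?_, ?_⟩, ?_⟩ <;>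
      simp [hs.reg_zero, hs.reg_one, hs.rreg_zero, hs.mem_zero, hs.reg_two, hs.reg_three,
        hs.reg_four, hmem]
  refine (hinit.seq fun s' hs' => Prog.ensures_forRange (T := 7) (N := x.numVertices)
    (I := fun k s => Merging x ε e ℓ s ∧ s.mem 4 =
      ⟨[], List.ofFn fun w : Fin _ => if w < k then mergeAlong ℓ e w else ℓ w⟩)
    ?_ (fun k s h => h.1.reg_zero) (fun k hk s h hk' => ?_) ?_).mono (by omega) fun s h => ?_
  · rintro k s v ⟨⟨⟨⟨h0, h1, hε, hd⟩, h2, h3, h4⟩, hr2, hr3, hr4, hr5⟩, hm⟩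
    exact ⟨⟨⟨⟨by simpa, by simpa, hε, hd⟩, by simpa, by simpa, by simpa⟩, hr2, hr3, hr4, hr5⟩, hm⟩
  · refine (ensures_mergeVertex (w := ⟨k, hk⟩) h.1 hk' h.2 (by simp)).mono le_rfl
      fun s' hs' => ⟨⟨hs'.1.1, hs'.1.2.trans ?_⟩, hs'.2⟩
    congr 2
    funext w
    simp only [Function.update_apply, Fin.ext_iff]
    grind
  · simpa using hs'
  · exact ⟨h.1.toAtEntry, by simpa using h.2⟩

/-- Implementation of `signedLabels`, with the result in array `4`. -/
def computeSignedLabels : Prog :=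
  .seq (.op (.clear 4)) (.seq (forVertices pushLabel) (forArcs mergeArc))

theorem ensures_computeSignedLabels (hs : Loaded x ε s) :
    computeSignedLabels.Ensures s (39 * (x.numVertices + 1) ^ 3) fun s' =>
      Loaded x ε s' ∧ HasLabels x.signedLabels s'.mem := by
  have hclear : (Prog.op (.clear 4)).Ensures s 1 fun s' =>
      Loaded x ε s' ∧ s'.mem 4 = ⟨[], List.ofFn (initialLabels 0)⟩ := by
    refine Prog.ensures_op trivial ⟨⟨?_, ?_, ?_, ?_⟩, ?_⟩ <;>
      simp [hs.reg_zero, hs.reg_one, hs.rreg_zero, hs.mem_zero]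
  refine (hclear.seq fun s' hs' => (ensures_forVertices
    (J := fun k m => m 4 = ⟨[], List.ofFn (initialLabels k)⟩)
    (fun u s hs hJ => ensures_pushLabel hs hJ) hs'.1 hs'.2).seq fun s' hs' => ensures_forArcs
      (J := fun L m => m 4 = ⟨[], List.ofFn (L.foldl mergeAlong (initialLabels _))⟩)
      (fun L e s hs hJ => by simpa using ensures_mergeArc hs hJ) hs'.1 hs'.2).mono
    (by ring_nf; nlinarith) fun s' hs' => ⟨hs'.1, hasLabels_of_eq hs'.2⟩

theorem ensures_clearLabels (hs : Loaded x ε s) :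
    (Prog.op (.clear 4)).Ensures s 1 fun s' =>
      Loaded x ε s' ∧ HasLabels (0 : Fin x.numVertices → ℝ) s'.mem := by
  refine Prog.ensures_op trivial ⟨⟨?_, ?_, ?_, ?_⟩, fun u => ?_⟩ <;>
    simp [hs.reg_zero, hs.reg_one, hs.rreg_zero, hs.mem_zero]

end WeightedGraph

/-! ### Writing the query and reading the answer -/

/-- The encoding of the constraint satisfaction problem that consists of the listed constraints. -/
def appsWord {n : ℕ} (l : List (ConstraintApp n)) : Word where
  nats := n :: l.flatMap ConstraintApp.natCode
  reals := l.flatMap ConstraintApp.realCode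

theorem appsWord_append_singleton {n : ℕ} (l : List (ConstraintApp n)) (a : ConstraintApp n) :
    appsWord (l ++ [a]) = ⟨(appsWord l).nats ++ a.natCode, (appsWord l).reals ++ a.realCode⟩ := by
  simp [appsWord]

theorem natCode_weightAtApp {n : ℕ} (b : Bool) (w : ℝ≥0) (u : Fin n) :
    (weightAtApp b w u).natCode = [1, (u : ℕ)] := rfl

theorem realCode_weightAtApp {n : ℕ} (b : Bool) (w : ℝ≥0) (u : Fin n) :
    (weightAtApp b w u).realCode = if b then [1, (w : ℝ)] else [(w : ℝ), 1] := by
  cases b <;> simp [weightAtApp, weightAt, ConstraintApp.realCode, valueTable]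

theorem natCode_condImpliesApp {n : ℕ} (t : Bool) (e : Fin n × Fin n) :
    (condImpliesApp t e).natCode = [2, (e.1 : ℕ), (e.2 : ℕ)] := rfl

theorem realCode_condImpliesApp {n : ℕ} (t : Bool) (e : Fin n × Fin n) :
    (condImpliesApp t e).realCode = [if t then 1 else 0, 1, if t then 0 else 1, 1] := by
  cases t <;> simp [condImpliesApp, condImplies, ConstraintApp.realCode, valueTable]

/-- Compare the label of the vertex in register `2` with `0`, and write the resulting bit to
register `6` and `0` to register `5`. -/
def loadSide : Prog :=
  .seq (.block [.rzero 1, .rload 3 4 2, .zero 5, .zero 6]) (.ite (.rlt 1 3) (.op (.succ 6)) .skip)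

theorem ensures_loadSide {n : ℕ} {ℓ : Fin n → ℝ} {s : Store} {u : Fin n} (hu : s.reg 2 = u)
    (hℓ : HasLabels ℓ s.mem) :
    loadSide.Ensures s 12 fun s' => s'.mem = s.mem ∧ s'.rreg 0 = s.rreg 0 ∧
      (∀ i < 5, s'.reg i = s.reg i) ∧ s'.reg 5 = 0 ∧ s'.reg 6 = (positiveSide ℓ u).toNat := by
  have hload : (Prog.block [.rzero 1, .rload 3 4 2, .zero 5, .zero 6]).Ensures s 9 fun s' =>
      (s'.mem = s.mem ∧ s'.rreg 0 = s.rreg 0 ∧ (∀ i < 5, s'.reg i = s.reg i) ∧ s'.reg 5 = 0) ∧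
        s'.reg 6 = 0 ∧ s'.rreg 1 = 0 ∧ s'.rreg 3 = ℓ u := by
    refine Prog.ensures_block (by simp) ⟨⟨?_, ?_, fun i hi => ?_, ?_⟩, ?_, ?_, ?_⟩
    case refine_3 =>
      simp [Function.update_of_ne (show i ≠ 6 by omega),
        Function.update_of_ne (show i ≠ 5 by omega)]
    all_goals simp [hu, hℓ u, -List.getD_eq_getElem?_getD]
  refine hload.seq fun s' ⟨⟨hmem, hr, hreg, h5⟩, h6, h1, h3⟩ =>
    Prog.ensures_ite (T := 1) (fun h => ?_) fun h => ?_
  all_goals rw [Test.holds, h1, h3] at h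
  · refine Prog.ensures_op trivial ⟨hmem, hr, fun i hi => ?_, ?_, ?_⟩
    · simp [Function.update_of_ne (show i ≠ 6 by omega), hreg i hi]
    · simp [h5]
    · simp [h6, positiveSide, h]
  · exact Prog.ensures_skip ⟨hmem, hr, hreg, h5, by simp [h6, positiveSide, h]⟩

/-- The bit in register `6` is `t`, provided that register `5` contains `0`. -/
def sideIs (t : Bool) : Test := bif t then .lt 5 6 else .eq 6 5

theorem holds_sideIs {s : Store} {t b : Bool} (h5 : s.reg 5 = 0) (h6 : s.reg 6 = b.toNat) :
    (sideIs t).holds s ↔ b = t := by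
  cases t <;> cases b <;> simp [sideIs, Test.holds, h5, h6]

/-- The bits which say whether the entries of `a` agree with `c`. -/
def agreementWord {n : ℕ} (c : Fin n → Bool) (a : Word) : Word :=
  bitWord fun u => decide (a.nats.getD u 0 = (c u).toNat)

theorem agreementWord_bitWord {n : ℕ} (c σ : Fin n → Bool) :
    agreementWord c (bitWord σ) = bitWord fun u => decide (u ∈ agreementSet c σ) := by
  have htoNat : ∀ a b : Bool, a.toNat = b.toNat ↔ a = b := by decide
  simp [agreementWord, bitWord, agreementSet, htoNat]

namespace WeightedGraph

variable {x : WeightedGraph} {ε : ℝ} {s : Store} {ℓ : Fin x.numVertices → ℝ}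

theorem AtVertex.congr {s' : Store} {u : Fin x.numVertices} (hs : AtVertex x ε u s)
    (hmem : s'.mem = s.mem) (hr : s'.rreg 0 = s.rreg 0) (hreg : ∀ i < 5, s'.reg i = s.reg i) :
    AtVertex x ε u s' := by
  refine ⟨⟨?_, ?_, ?_, ?_⟩, ?_⟩ <;>
    simp [hs.reg_zero, hs.reg_one, hs.rreg_zero, hs.mem_zero, hs.reg_two, hmem, hr, hreg]

theorem AtEntry.congr {s' : Store} {e : Fin x.numVertices × Fin x.numVertices}
    (hs : AtEntry x ε e s) (hmem : s'.mem = s.mem) (hr : s'.rreg 0 = s.rreg 0)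
    (hreg : ∀ i < 5, s'.reg i = s.reg i) : AtEntry x ε e s' := by
  refine ⟨⟨?_, ?_, ?_, ?_⟩, ?_, ?_, ?_⟩ <;>
    simp [hs.reg_zero, hs.reg_one, hs.rreg_zero, hs.mem_zero, hs.reg_two, hs.reg_three,
      hs.reg_four, hmem, hr, hreg]

/-- Append the unary constraint at the vertex in register `2` to the query in array `1`. -/
def emitWeight : Prog :=
  .seq loadSide
    (.seq (.block [.succ 5, .push 1 5, .push 1 2, .rone 2, .rload 4 0 2, .zero 5])
      (.ite (sideIs true) (.block [.rpush 1 2, .rpush 1 4]) (.block [.rpush 1 4, .rpush 1 2])))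

theorem ensures_emitWeight {u : Fin x.numVertices} {l : List (ConstraintApp x.numVertices)}
    (hs : AtVertex x ε u s) (hℓ : HasLabels ℓ s.mem) (hquery : s.mem 1 = appsWord l) :
    emitWeight.Ensures s 33 fun s' => AtVertex x ε u s' ∧ HasLabels ℓ s'.mem ∧
      s'.mem 1 = appsWord (l ++ [weightAtApp (positiveSide ℓ u) (x.weight u) u]) := by
  have hside : loadSide.Ensures s 12 fun s' =>
      (AtVertex x ε u s' ∧ HasLabels ℓ s'.mem ∧ s'.mem 1 = appsWord l) ∧
        s'.reg 5 = 0 ∧ s'.reg 6 = (positiveSide ℓ u).toNat :=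
    (ensures_loadSide hs.reg_two hℓ).mono le_rfl fun s' ⟨hmem, hr, hreg, h⟩ =>
      ⟨⟨hs.congr hmem hr hreg, by rwa [hmem], by rwa [hmem]⟩, h⟩
  refine hside.seq (T' := 20) fun s₁ ⟨⟨hs₁, hℓ₁, hm₁⟩, h5, h6⟩ => ?_
  have hnats : (Prog.block [.succ 5, .push 1 5, .push 1 2, .rone 2, .rload 4 0 2, .zero 5]).Ensures
      s₁ 13 fun s' => (AtVertex x ε u s' ∧ HasLabels ℓ s'.mem) ∧
        (s'.reg 5 = 0 ∧ s'.reg 6 = (positiveSide ℓ u).toNat) ∧ (s'.rreg 2 = 1 ∧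
          s'.rreg 4 = x.weight u) ∧ s'.mem 1 = ⟨(appsWord l).nats ++ [1, (u : ℕ)],
            (appsWord l).reals⟩ := by
    refine Prog.ensures_block (by simp) ⟨⟨⟨⟨?_, ?_, ?_, ?_⟩, ?_⟩, fun v => ?_⟩, ⟨?_, ?_⟩,
      ⟨?_, ?_⟩, ?_⟩ <;>
      simp [hs₁.reg_zero, hs₁.reg_one, hs₁.rreg_zero, hs₁.mem_zero, hs₁.reg_two, hℓ₁ _, h5, h6, hm₁,
        enc_reals_getD, -List.getD_eq_getElem?_getD]
  refine hnats.seq (T' := 6) fun s₂ ⟨⟨hs₂, hℓ₂⟩, ⟨h5, h6⟩, ⟨hr2, hr4⟩, hm₂⟩ =>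
    Prog.ensures_ite (fun h => ?_) fun h => ?_
  all_goals
    rw [holds_sideIs h5 h6] at h
    rw [appsWord_append_singleton, natCode_weightAtApp, realCode_weightAtApp]
    refine Prog.ensures_block (by simp) ⟨⟨⟨?_, ?_, ?_, ?_⟩, ?_⟩, fun v => ?_, ?_⟩ <;>
      simp [hs₂.reg_zero, hs₂.reg_one, hs₂.rreg_zero, hs₂.mem_zero, hs₂.reg_two, hℓ₂ _, hm₂, hr2,
        hr4, h, -List.getD_eq_getElem?_getD]

/-- Append the constraint on the arc in the registers `2` and `3` to the query in array `1`, if its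
tail is selected by `t`. The value table of `condImplies t` is `(t, 1, ¬t, 1)`, and the real
registers `1` and `2` hold `0` and `1`. -/
def emitArc (t : Bool) : Prog :=
  .seq loadSide (.ite (sideIs t)
    (.block [.succ 5, .succ 5, .push 1 5, .push 1 2, .push 1 3, .rzero 1, .rone 2,
      .rpush 1 (t.toNat + 1), .rpush 1 2, .rpush 1 ((!t).toNat + 1), .rpush 1 2]) .skip)

theorem ensures_emitArc (t : Bool) {e : Fin x.numVertices × Fin x.numVertices}
    {l : List (ConstraintApp x.numVertices)} (hs : AtEntry x ε e s) (hℓ : HasLabels ℓ s.mem)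
    (hquery : s.mem 1 = appsWord l) :
    (emitArc t).Ensures s 37 fun s' => AtEntry x ε e s' ∧ HasLabels ℓ s'.mem ∧
      s'.mem 1 = appsWord (l ++ if positiveSide ℓ e.1 = t then [condImpliesApp t e] else []) := by
  have hside : loadSide.Ensures s 12 fun s' =>
      (AtEntry x ε e s' ∧ HasLabels ℓ s'.mem ∧ s'.mem 1 = appsWord l) ∧
        s'.reg 5 = 0 ∧ s'.reg 6 = (positiveSide ℓ e.1).toNat :=
    (ensures_loadSide hs.reg_two hℓ).mono le_rfl fun s' ⟨hmem, hr, hreg, h⟩ =>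
      ⟨⟨hs.congr hmem hr hreg, by rwa [hmem], by rwa [hmem]⟩, h⟩
  refine hside.seq fun s₁ ⟨⟨hs₁, hℓ₁, hm₁⟩, h5, h6⟩ =>
    Prog.ensures_ite (T := 23) (fun h => ?_) fun h => ?_
  all_goals rw [holds_sideIs h5 h6] at h
  · rw [if_pos h, appsWord_append_singleton, natCode_condImpliesApp, realCode_condImpliesApp]
    refine Prog.ensures_block (by simp) ⟨⟨⟨?_, ?_, ?_, ?_⟩, ?_, ?_, ?_⟩, fun v => ?_, ?_⟩
    case refine_9 => cases t <;> simp [h5, hm₁, hs₁.reg_two, hs₁.reg_three]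
    all_goals
      simp [hs₁.reg_zero, hs₁.reg_one, hs₁.rreg_zero, hs₁.mem_zero, hs₁.reg_two, hs₁.reg_three,
        hs₁.reg_four, hℓ₁ _, -List.getD_eq_getElem?_getD]
  · rw [if_neg h, List.append_nil]
    exact (Prog.ensures_skip ⟨hs₁, hℓ₁, hm₁⟩).mono (by omega) fun _ h => h

/-- Write the encoding of `toCSP` to array `1`. -/
def emitQuery (t : Bool) : Prog :=
  .seq (.block [.clear 1, .push 1 0]) (.seq (forVertices emitWeight) (forArcs (emitArc t)))

theorem ensures_emitQuery (t : Bool) (hs : Loaded x ε s) (hℓ : HasLabels ℓ s.mem) :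
    (emitQuery t).Ensures s (61 * (x.numVertices + 1) ^ 3) fun s' =>
      Loaded x ε s' ∧ HasLabels ℓ s'.mem ∧ s'.mem 1 = (x.toCSP t (positiveSide ℓ)).enc := by
  let c := positiveSide ℓ
  let weightApps (k : ℕ) : List (ConstraintApp x.numVertices) :=
    ((List.finRange _).take k).map fun u => weightAtApp (c u) (x.weight u) u
  let arcApps (L : List (Fin x.numVertices × Fin x.numVertices)) :=
    (L.filter fun e => c e.1 = t).map (condImpliesApp t)
  have hstart : (Prog.block [.clear 1, .push 1 0]).Ensures s 5 fun s' =>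
      Loaded x ε s' ∧ HasLabels ℓ s'.mem ∧ s'.mem 1 = appsWord (weightApps 0) := by
    refine Prog.ensures_block (by simp) ⟨⟨?_, ?_, ?_, ?_⟩, fun v => ?_, ?_⟩ <;>
      simp [hs.reg_zero, hs.reg_one, hs.rreg_zero, hs.mem_zero, hℓ _, weightApps, appsWord,
        -List.getD_eq_getElem?_getD]
  refine (hstart.seq fun s' hs' => (ensures_forVertices
    (T := 33) (J := fun k m => HasLabels ℓ m ∧ m 1 = appsWord (weightApps k))
    (fun u s hs hJ => ?_) hs'.1 hs'.2).seq fun s' hs' => ensures_forArcs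
      (T := 37)
      (J := fun L m => HasLabels ℓ m ∧ m 1 = appsWord (weightApps x.numVertices ++ arcApps L))
      (fun L e s hs hJ => ?_) hs'.1 ?_).mono (by ring_nf; nlinarith) fun s' hs' => ?_
  · simpa [weightApps, take_succ_finRange, -List.map_take] using ensures_emitWeight hs hJ.1 hJ.2
  · have harcs : arcApps (L ++ [e]) =
        arcApps L ++ if positiveSide ℓ e.1 = t then [condImpliesApp t e] else [] := by
      by_cases he : positiveSide ℓ e.1 = t <;> simp [arcApps, c, he]
    rw [harcs, ← List.append_assoc]
    exact ensures_emitArc t hs hJ.1 hJ.2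
  · simpa [arcApps] using hs'.2
  · have happs : weightApps x.numVertices ++ arcApps x.arcs = (x.toCSP t c).apps := by
      simp only [weightApps, List.take_of_length_le (List.length_finRange).le]
      rfl
    rwa [happs] at hs'

/-- Append to array `3` the bit which says whether the answer in array `2` selects the vertex in
register `2`. -/
def decodeVertex : Prog :=
  .seq loadSide (.seq (.op (.load 7 2 2))
    (.seq (.ite (.eq 7 6) (.op (.succ 5)) .skip) (.op (.push 3 5))))

/-- Implementation of `agreementWord`, from array `2` to array `3`. -/
def decodeAnswer : Prog := .seq (.op (.clear 3)) (forVertices decodeVertex)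

theorem ensures_decodeVertex {a d : Word} {u : Fin x.numVertices} (hs : AtVertex x ε u s)
    (hℓ : HasLabels ℓ s.mem) (hanswer : s.mem 2 = a) (hout : s.mem 3 = d) :
    decodeVertex.Ensures s 19 fun s' => AtVertex x ε u s' ∧ HasLabels ℓ s'.mem ∧ s'.mem 2 = a ∧
      s'.mem 3 =
        ⟨d.nats ++ [(decide (a.nats.getD u 0 = (positiveSide ℓ u).toNat)).toNat], d.reals⟩ := by
  let I (s' : Store) : Prop :=
    AtVertex x ε u s' ∧ HasLabels ℓ s'.mem ∧ s'.mem 2 = a ∧ s'.mem 3 = d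
  have hside : loadSide.Ensures s 12 fun s' =>
      I s' ∧ s'.reg 5 = 0 ∧ s'.reg 6 = (positiveSide ℓ u).toNat :=
    (ensures_loadSide hs.reg_two hℓ).mono le_rfl fun s' ⟨hmem, hr, hreg, h⟩ =>
      ⟨⟨hs.congr hmem hr hreg, by rwa [hmem], by rwa [hmem], by rwa [hmem]⟩, h⟩
  refine hside.seq (T' := 6) fun s₁ ⟨⟨hs₁, hℓ₁, ha₁, hd₁⟩, h5, h6⟩ => ?_
  have hload : (Prog.op (.load 7 2 2)).Ensures s₁ 1 fun s' => I s' ∧ s'.reg 5 = 0 ∧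
      s'.reg 6 = (positiveSide ℓ u).toNat ∧ s'.reg 7 = a.nats.getD u 0 := by
    refine Prog.ensures_op trivial ⟨⟨⟨⟨?_, ?_, ?_, ?_⟩, ?_⟩, hℓ₁, ha₁, hd₁⟩, ?_, ?_, ?_⟩ <;>
      simp [hs₁.reg_zero, hs₁.reg_one, hs₁.rreg_zero, hs₁.mem_zero, hs₁.reg_two, h5, h6, ha₁]
  refine hload.seq (T' := 4) fun s₂ ⟨⟨hs₂, hℓ₂, ha₂, hd₂⟩, h5, h6, h7⟩ => ?_
  have hcompare : (Prog.ite (.eq 7 6) (.op (.succ 5)) .skip).Ensures s₂ 2 fun s' => I s' ∧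
      s'.reg 5 = (decide (a.nats.getD u 0 = (positiveSide ℓ u).toNat)).toNat := by
    refine Prog.ensures_ite (T := 1) (fun h => ?_) fun h => ?_
    all_goals rw [Test.holds, h6, h7] at h
    · refine Prog.ensures_op trivial ⟨⟨⟨⟨?_, ?_, ?_, ?_⟩, ?_⟩, hℓ₂, ha₂, hd₂⟩, ?_⟩ <;>
        simp [hs₂.reg_zero, hs₂.reg_one, hs₂.rreg_zero, hs₂.mem_zero, hs₂.reg_two, h5, h,
          -List.getD_eq_getElem?_getD]
    · exact Prog.ensures_skip
        ⟨⟨hs₂, hℓ₂, ha₂, hd₂⟩, by rw [h5, decide_eq_false h, Bool.toNat_false]⟩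
  refine hcompare.seq (T' := 1) fun s₃ ⟨⟨hs₃, hℓ₃, ha₃, hd₃⟩, h5⟩ => ?_
  refine Prog.ensures_op trivial ⟨⟨⟨?_, ?_, ?_, ?_⟩, ?_⟩, fun v => ?_, ?_, ?_⟩ <;>
    simp [hs₃.reg_zero, hs₃.reg_one, hs₃.rreg_zero, hs₃.mem_zero, hs₃.reg_two, hℓ₃ _, ha₃, hd₃, h5,
      -List.getD_eq_getElem?_getD]

theorem ensures_decodeAnswer {a : Word} (hs : Loaded x ε s) (hℓ : HasLabels ℓ s.mem)
    (hanswer : s.mem 2 = a) :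
    decodeAnswer.Ensures s (22 * (x.numVertices + 1) ^ 3) fun s' =>
      s'.mem 3 = agreementWord (positiveSide ℓ) a := by
  have hclear : (Prog.op (.clear 3)).Ensures s 1 fun s' => Loaded x ε s' ∧
      HasLabels ℓ s'.mem ∧ s'.mem 2 = a ∧ s'.mem 3 = ⟨[], []⟩ := by
    refine Prog.ensures_op trivial ⟨⟨?_, ?_, ?_, ?_⟩, fun v => ?_, ?_, ?_⟩ <;>
      simp [hs.reg_zero, hs.reg_one, hs.rreg_zero, hs.mem_zero, hℓ _, hanswer,
        -List.getD_eq_getElem?_getD]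
  refine (hclear.seq fun s' hs' => ensures_forVertices (T := 19)
    (J := fun k m => HasLabels ℓ m ∧ m 2 = a ∧
      m 3 = ⟨(agreementWord (positiveSide ℓ) a).nats.take k, []⟩)
    (fun u s hs hJ => ?_) hs'.1 (by simpa using hs'.2)).mono (by ring_nf; nlinarith)
      fun s' hs' => ?_
  · have hnext := ensures_decodeVertex hs hJ.1 hJ.2.1 hJ.2.2
    rw [List.take_add_one, List.getElem?_eq_getElem (by simp [agreementWord, bitWord])]
    simpa [agreementWord, bitWord] using hnext
  · rw [hs'.2.2.2, List.take_of_length_le (by simp [agreementWord, bitWord])]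
    rfl

/-- Establish `Loaded`; the number of entries is one less than the length of the encoding. -/
def loadInput : Prog := .block [.load 0 0 0, .len 1 0, .pred 1]

theorem ensures_loadInput (p : Prog) :
    loadInput.Ensures (p.start x.enc ε).store 7 (Loaded x ε) := by
  refine Prog.ensures_block (by simp) ⟨?_, ?_, ?_, ?_⟩ <;> simp [Prog.start, enc]

theorem numVertices_lt_size_enc (x : WeightedGraph) : x.numVertices < x.enc.size := by
  simp [enc, Word.size]

theorem queriesOnce (t : Bool) {labelling : Prog} {b : ℕ}
    (hlabel : ∀ s, Loaded x ε s → labelling.Ensures s (b * (x.numVertices + 1) ^ 3) fun s' =>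
      Loaded x ε s' ∧ HasLabels ℓ s'.mem) :
    ∃ T T' : ℕ, T + T' + 3 ≤ (b + 95) * (x.enc.size + 1) ^ 3 ∧
      Prog.QueriesOnce (.seq loadInput (.seq labelling (emitQuery t))) decodeAnswer x.enc ε T T'
        (x.toCSP t (positiveSide ℓ)).enc (agreementWord (positiveSide ℓ)) := by
  refine ⟨_, _, ?_, ((ensures_loadInput _).seq fun s hs => (hlabel s hs).seq fun s' hs' =>
    ensures_emitQuery t hs'.1 hs'.2).mono le_rfl fun s hs => ⟨hs.2.2, hs.1.rreg_zero, fun a =>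
      ensures_decodeAnswer ⟨hs.1.reg_zero, hs.1.reg_one, hs.1.rreg_zero, ?_⟩ ?_ ?_⟩⟩
  · have hpow := Nat.pow_le_pow_left (show x.numVertices + 1 ≤ x.enc.size + 1 by
      have := x.numVertices_lt_size_enc; omega) 3
    have hpos : 1 ≤ (x.numVertices + 1) ^ 3 := Nat.one_le_pow _ _ (by omega)
    nlinarith [Nat.mul_le_mul_left b hpow]
  · simpa [Function.update_of_ne] using hs.1.mem_zero
  · exact hs.2.1
  · simp

end WeightedGraph

theorem aptReduces_of_isSelector {I : Type} {g : I → WeightedGraph}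
    {hg : Function.Injective g} {t : Bool} {ℓ : ∀ i, Fin (g i).numVertices → ℝ}
    (hℓ : ∀ i, (g i).IsSelector t (positiveSide (ℓ i))) {labelling : Prog} {b : ℕ}
    (hlabel : ∀ i ε s, (g i).Loaded ε s →
      labelling.Ensures s (b * ((g i).numVertices + 1) ^ 3) fun s' =>
        (g i).Loaded ε s' ∧ HasLabels (ℓ i) s'.mem) :
    APTReduces (maxProdISOn g hg) (maxProdCSPStar {condImplies t}) := by
  refine aptReduces_of_queriesOnce (P := maxProdISOn g hg) (Q := maxProdCSPStar {condImplies t})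
    (f := fun i => (g i).toCSP t (positiveSide (ℓ i))) (b + 95) 3
    (fun i ε => WeightedGraph.queriesOnce t (hlabel i ε)) fun i ε _ _ σ hσ => ?_
  obtain ⟨A, hA, happrox⟩ := (hℓ i).exists_isApprox (hg := hg) (by positivity) hσ
  refine ⟨A, ?_, happrox⟩
  exact (congrArg (fun B : Finset _ => bitWord fun u => decide (u ∈ B)) hA).trans
    (agreementWord_bitWord _ σ).symm

theorem maxProdIS_aptReduces : APTReduces maxProdIS (maxProdCSPStar {constraintOR}) := by
  rw [← condImplies_false]
  exact aptReduces_of_isSelector (g := id) (hg := Function.injective_id) (b := 1)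
    WeightedGraph.isSelector_false fun x ε s hs => (WeightedGraph.ensures_clearLabels hs).mono
      (by rw [one_mul]; exact Nat.one_le_pow _ _ (by omega)) fun _ h => h

theorem maxProdBIS_aptReduces : APTReduces maxProdBIS (maxProdCSPStar {constraintImplies}) := by
  rw [← condImplies_true]
  exact aptReduces_of_isSelector (g := Subtype.val) (hg := Subtype.val_injective) (t := true)
    (fun x => WeightedGraph.isSelector_signedLabels x.2)
    fun _ _ _ => WeightedGraph.ensures_computeSignedLabels

end

theorem mainTheorem9 :
    APTReduces maxProdIS (maxProdCSPStar {constraintOR}) ∧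
      APTReduces maxProdBIS (maxProdCSPStar {constraintImplies}) :=
  ⟨maxProdIS_aptReduces, maxProdBIS_aptReduces⟩
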